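/- Let $\Gamma$ be a finite digraph without loops. For vertices $x,y$ let $\partial_\Gamma(x,y)$ be the length of a shortest directed path from $x$ to $y$, let $\tilde\partial_\Gamma(x,y)=(\partial_\Gamma(x,y),\partial_\Gamma(y,x))$ be the two-way distance, let $\tilde\partial(\Gamma)=\{\tilde\partial_\Gamma(x,y)\mid x,y\in V(\Gamma)\}$, and for $\tilde i\in\tilde\partial(\Gamma)$ put $\Gamma_{\tilde i}=\{(x,y)\mid\tilde\partial_\Gamma(x,y)=\tilde i\}$. Assume that $\Gamma$ is a commutative weakly distance-regular digraph, i.e. $\Gamma$ is strongly connected and $(V(\Gamma),\{\Gamma_{\tilde i}\}_{\tilde i\in\tilde\partial(\Gamma)})$ is a non-symmetric commutative association scheme. Let $\Sigma$ be the underlying graph of $\Gamma$ (distinct $x,y$ are adjacent if and only if $(x,y)$ or $(y,x)$ is an arc of $\Gamma$). Assume that, up to isomorphism, either $\Sigma$ is the Johnson graph $J(m,e)$ with $e\ge 2$ and $m\ge 2e$ (vertices: the $e$-subsets of an $m$-set; $x,y$ adjacent when $|x\cap y|=e-1$), or $\Sigma$ is the folded Johnson graph $\bar J(2e,e)$ with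 $e\ge 4$ and $m=2e$ (vertices: the partitions of a $2e$-set into two $e$-sets; the partitions containing the $e$-sets $x$ and $y$ respectively are adjacent when $|x\cap y|\in\{1,e-1\}$). Let $T=\{q+1\mid(1,q)\in\tilde\partial(\Gamma)\}$. If $T=\{3\}$, i.e. if every arc $(x,y)$ of $\Gamma$ satisfies $\partial_\Gamma(y,x)=2$, then $\Sigma$ is isomorphic to the Johnson graph $J(m,2)$. In particular, $\Sigma$ is not isomorphic to any Johnson graph $J(n',e')$ with $e'>2$ and $n'\ge 2e'$, nor to any folded Johnson graph $\bar J(2e',e')$ with $e'\ge 4$. -/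

import Mathlib

namespace WDRD

/-! ### Association schemes -/

section Scheme

variable {X I : Type*}

/-- The number of `z` with `(x, z) ∈ R i` and `(z, y) ∈ R j`. -/
noncomputable def interCount (R : I → Set (X × X)) (i j : I) (x y : X) : ℕ :=
  {z : X | (x, z) ∈ R i ∧ (z, y) ∈ R j}.ncard

/-- The family of relations `R` on the (finite) set `X` is an association scheme. -/
structure IsAssociationScheme (R : I → Set (X × X)) : Prop where
  nonempty : ∀ i, (R i).Nonempty
  diagonal : ∃ i, R i = {p | p.1 = p.2}
  partition : ∀ p : X × X, ∃! i, p ∈ R i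
  transpose : ∀ i, ∃ i', R i' = {p | p.swap ∈ R i}
  interNumber : ∀ i j l, ∃ c : ℕ, ∀ x y, (x, y) ∈ R l → interCount R i j x y = c

/-- All relations are symmetric. -/
def IsSymmetricFamily (R : I → Set (X × X)) : Prop :=
  ∀ i, {p | p.swap ∈ R i} = R i

/-- `p_{i,j}^l = p_{j,i}^l` for all `i, j, l`. -/
def IsCommutativeFamily (R : I → Set (X × X)) : Prop :=
  ∀ i j l x y, (x, y) ∈ R l → interCount R i j x y = interCount R j i x y

end Scheme

/-! ### Digraphs -/

section Digraphs

variable {V : Type*}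

/-- There is a path of length `r` from `x` to `y`. -/
def HasPath (Γ : Digraph V) (r : ℕ) (x y : V) : Prop :=
  ∃ w : ℕ → V, w 0 = x ∧ w r = y ∧ ∀ t < r, Γ.Adj (w t) (w (t + 1))

def StronglyConnected (Γ : Digraph V) : Prop :=
  ∀ x y, ∃ r, HasPath Γ r x y

/-- The length of a shortest path from `x` to `y` (used for strongly connected digraphs only). -/
noncomputable def dist (Γ : Digraph V) (x y : V) : ℕ :=
  sInf {r | HasPath Γ r x y}

/-- The two-way distance. -/
noncomputable def twoDist (Γ : Digraph V) (x y : V) : ℕ × ℕ :=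
  (dist Γ x y, dist Γ y x)

/-- The two-way distance set. -/
def twoDistSet (Γ : Digraph V) : Set (ℕ × ℕ) :=
  {i | ∃ x y, twoDist Γ x y = i}

/-- The relations of the attached configuration, indexed by the two-way distance set. -/
def attached (Γ : Digraph V) (i : twoDistSet Γ) : Set (V × V) :=
  {p | twoDist Γ p.1 p.2 = i}

/-- A digraph (without loops) is weakly distance-regular if it is strongly connected and its
attached configuration is a non-symmetric association scheme. -/
structure IsWeaklyDistanceRegular (Γ : Digraph V) : Prop where
  loopless : ∀ x, ¬ Γ.Adj x x
  stronglyConnected : StronglyConnected Γ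
  scheme : IsAssociationScheme (attached Γ)
  nonSymmetric : ¬ IsSymmetricFamily (attached Γ)

/-- Commutative weakly distance-regular digraphs. -/
structure IsCommWeaklyDistanceRegular (Γ : Digraph V) : Prop
    extends IsWeaklyDistanceRegular Γ where
  commutative : IsCommutativeFamily (attached Γ)

/-- The set `T` of all `q + 1` such that some arc has type `(1, q)`. -/
def arcTypes (Γ : Digraph V) : Set ℕ :=
  {t | ∃ q, (1, q) ∈ twoDistSet Γ ∧ t = q + 1}

end Digraphs

/-! ### Johnson graphs and folded Johnson graphs -/

/-- The Johnson graph `J(n, e)`: the `e`-subsets of an `n`-set, adjacent when they meet in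
`e - 1` elements. -/
def johnson (n e : ℕ) : SimpleGraph {x : Finset (Fin n) // x.card = e} where
  Adj x y := (x.1 ∩ y.1).card + 1 = e
  symm := ⟨fun x y h => by rw [Finset.inter_comm]; exact h⟩
  loopless := ⟨fun x h => by rw [Finset.inter_self, x.2] at h; omega⟩

/-- The folded Johnson graph `J̄(2e, e)`: the partitions `{x, xᶜ}` of a `2e`-set into two `e`-sets.
Two partitions with blocks `x` and `y` are adjacent when `|x ∩ y| ∈ {1, e - 1}`, i.e. when
their common refinement has blocks of sizes `1, e - 1, 1, e - 1`. -/
def foldedJohnson (e : ℕ) :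
    SimpleGraph {P : Finset (Finset (Fin (2 * e))) // ∃ x, x.card = e ∧ P = {x, xᶜ}} where
  Adj P Q := P ≠ Q ∧ ∃ x ∈ P.1, ∃ y ∈ Q.1, (x ∩ y).card = 1 ∨ (x ∩ y).card + 1 = e
  symm := ⟨fun P Q h => by
    obtain ⟨hne, x, hx, y, hy, h⟩ := h
    exact ⟨hne.symm, y, hy, x, hx, by rwa [Finset.inter_comm]⟩⟩
  loopless := ⟨fun P h => h.1 rfl⟩

end WDRD

/-! Let `A` be the adjacency matrix of `Γ`. As every arc has type `(1, 2)`, `A` and `Aᵀ` are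
relation matrices of the scheme, so `N = A + Aᵀ` is the adjacency matrix of the underlying graph and
commutes with the skew signing `S = A - Aᵀ`. It suffices to exclude such a signing on `J(n, e)` with
`e ≥ 3`. The folded graph is treated alongside, because only the neighbourhood grids and functions
invariant under complement are used.

At an `e`-set `x` the signs form an `e × (n - e)` matrix `M x a b`. Counting triangles on an edge
gives `row sum + column sum = μ * entry`, and this forces all row and column sums to vanish
(`row_col_eq_zero`). Hence `S` kills constants and the indicators `i ∈ x`. For the function
`separates i j`, `N` acts as multiplication by the eigenvalue `θ₂ = (e - 2)(n - e - 2) - 2` up to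
such terms, so `S (separates i j)` is a `θ₂`-eigenfunction. It is supported on the sets separating
`i` and `j`, where its values are `± 2`. Therefore `C ↦ M (C ∪ {i}) i j` is an eigenfunction of `J(n
- 2, e - 1)` for eigenvalue `θ₂ + 1`, the second largest one, and so it is linear: `∑ l ∈ C, c i l`
(`exists_linear`).

Values `± 1` make the coefficients `c i l` equal to one number `t i`, with at most one exception
(`exists_const_of_sum_eq_one_or_neg_one`), while zero column sums make `c` skew
(`skew_of_sum_eq_zero`). So `t l = -t i` for generic pairs, which is impossible for three indices
(`IsRegularSigning.false_of_three_le`). -/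

namespace WDRD

/-! ### Functions on the `k`-subsets of a finite set -/

section Slice

open Finset

variable {α : Type*} [DecidableEq α]

/-- The sum of `h` over the supersets of `B` in `G` with one more element. -/
def shadowSum (G : Finset α) (h : Finset α → ℚ) (B : Finset α) : ℚ :=
  ∑ b ∈ G \ B, h (insert b B)

/-- The adjacency operator of the Johnson graph on the subsets of `G`. -/
def swapSum (G : Finset α) (h : Finset α → ℚ) (C : Finset α) : ℚ :=
  ∑ a ∈ C, ∑ b ∈ G \ C, h (insert b (C.erase a))

/-- The double exchange sum on the right also occurs in `shadowSum_swapSum`. Subtracting the two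
identities shows that the shadow intertwines the adjacency operators of consecutive Johnson graphs
up to a scalar. -/
theorem swapSum_shadowSum {G B : Finset α} (hB : B ⊆ G) (h : Finset α → ℚ) :
    swapSum G (shadowSum G h) B = B.card * shadowSum G h B +
      ∑ a ∈ B, ∑ b ∈ G \ B, ∑ c ∈ (G \ B).erase b, h (insert c (insert b (B.erase a))) := by
  have key : ∀ a ∈ B, ∑ b ∈ G \ B, shadowSum G h (insert b (B.erase a)) =
      shadowSum G h B +
        ∑ b ∈ G \ B, ∑ c ∈ (G \ B).erase b, h (insert c (insert b (B.erase a))) := by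
    intro a ha
    rw [shadowSum, ← sum_add_distrib]
    refine sum_congr rfl fun b hb => ?_
    rw [mem_sdiff] at hb
    have h1 : G \ insert b (B.erase a) = insert a ((G \ B).erase b) := by
      ext z
      have := hB ha
      simp only [mem_sdiff, mem_insert, mem_erase]
      by_cases hz : z = a
      · subst hz; simp_all; rintro rfl; exact hb.2 ha
      · simp_all; tauto
    have h2 : a ∉ (G \ B).erase b := by simp [ha]
    have h3 : insert a (insert b (B.erase a)) = insert b B := by
      rw [insert_comm, insert_erase ha]
    rw [shadowSum, h1, sum_insert h2, h3]
  rw [swapSum, sum_congr rfl key, sum_add_distrib, sum_const, nsmul_eq_mul]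

theorem shadowSum_swapSum {G B : Finset α} (hB : B ⊆ G) (h : Finset α → ℚ) :
    shadowSum G (swapSum G h) B = ((G.card : ℚ) - B.card - 1) * shadowSum G h B +
      ∑ a ∈ B, ∑ b ∈ G \ B, ∑ c ∈ (G \ B).erase b, h (insert c (insert b (B.erase a))) := by
  have key : ∀ c ∈ G \ B, swapSum G h (insert c B) =
      (∑ b ∈ (G \ B).erase c, h (insert b B)) +
        ∑ a ∈ B, ∑ b ∈ (G \ B).erase c, h (insert b (insert c (B.erase a))) := by
    intro c hc
    rw [mem_sdiff] at hc
    have h1 : G \ insert c B = (G \ B).erase c := by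
      ext z; simp only [mem_sdiff, mem_insert, mem_erase]; tauto
    rw [swapSum, sum_insert hc.2, erase_insert hc.2, h1]
    congr 1
    refine sum_congr rfl fun a ha => sum_congr rfl fun b _ => ?_
    rw [erase_insert_of_ne (ne_of_mem_of_not_mem ha hc.2).symm]
  have h2 : ∑ c ∈ G \ B, ∑ b ∈ (G \ B).erase c, h (insert b B) =
      ((G.card : ℚ) - B.card - 1) * shadowSum G h B := by
    have : ∀ c ∈ G \ B, ∑ b ∈ (G \ B).erase c, h (insert b B) =
        shadowSum G h B - h (insert c B) := by
      intro c hc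
      rw [shadowSum, ← add_sum_erase _ _ hc]; ring
    rw [sum_congr rfl this, sum_sub_distrib, sum_const, nsmul_eq_mul, card_sdiff_of_subset hB,
      Nat.cast_sub (card_le_card hB)]
    simp only [shadowSum]
    ring
  rw [shadowSum, sum_congr rfl key, sum_add_distrib, h2, sum_comm]

/-- Recovers an eigenfunction from its shadow whenever `C.card` plus the eigenvalue is nonzero. -/
theorem sum_shadowSum_erase {G C : Finset α} (hC : C ⊆ G) (h : Finset α → ℚ) :
    ∑ a ∈ C, shadowSum G h (C.erase a) = C.card * h C + swapSum G h C := by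
  have key : ∀ a ∈ C, shadowSum G h (C.erase a) =
      h C + ∑ b ∈ G \ C, h (insert b (C.erase a)) := by
    intro a ha
    have h1 : G \ C.erase a = insert a (G \ C) := by
      ext z
      have := hC ha
      simp only [mem_sdiff, mem_insert, mem_erase]
      by_cases hz : z = a
      · subst hz; simp_all
      · simp_all
    rw [shadowSum, h1, sum_insert (by simp [ha]), insert_erase ha]
  rw [sum_congr rfl key, sum_add_distrib, sum_const, nsmul_eq_mul, swapSum]

/-- An eigenfunction of the Johnson graph for the second largest eigenvalue is linear. -/
theorem exists_linear_of_swapSum_eq (G : Finset α) (k : ℕ) (hk : 1 ≤ k) :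
    k < G.card → ∀ h : Finset α → ℚ,
      (∀ C ⊆ G, C.card = k →
        swapSum G h C = (((k : ℚ) - 1) * (G.card - k - 1) - 1) * h C) →
      ∃ c : α → ℚ, ∀ C ⊆ G, C.card = k → h C = ∑ l ∈ C, c l := by
  induction k, hk using Nat.le_induction with
  | base =>
    intro _ h _
    refine ⟨fun l => h {l}, fun C _ hC => ?_⟩
    obtain ⟨a, rfl⟩ := card_eq_one.1 hC
    simp
  | succ k hk ih =>
    intro hkG h hh
    -- The shadow of an eigenfunction for the second eigenvalue is one again, a level lower: with `N
    -- = |G|`, `k(N - k - 2) - 1 + (2k + 1 - N) = (k - 1)(N - k - 1) - 1`.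
    obtain ⟨c, hc⟩ := ih (by omega) (shadowSum G h) (by
      intro B hB hBk
      have h1 := swapSum_shadowSum hB h
      have h2 := shadowSum_swapSum hB h
      have h3 : shadowSum G (swapSum G h) B =
          ((((k + 1 : ℕ) : ℚ) - 1) * (G.card - (k + 1 : ℕ) - 1) - 1) * shadowSum G h B := by
        rw [shadowSum, shadowSum, mul_sum]
        refine sum_congr rfl fun b hb => hh _ ?_ ?_
        · exact insert_subset (mem_sdiff.1 hb).1 hB
        · rw [card_insert_of_notMem (mem_sdiff.1 hb).2, hBk]
      rw [h3] at h2
      rw [hBk] at h1 h2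
      push_cast at h2
      linear_combination h1 - h2)
    have hpos : (k : ℚ) * (G.card - k - 1) ≠ 0 := by
      have : ((k + 1 : ℕ) : ℚ) < G.card := by exact_mod_cast hkG
      have : (0 : ℚ) < k := by exact_mod_cast hk
      push_cast at *
      have : (0 : ℚ) < G.card - k - 1 := by linarith
      positivity
    -- Summing the linear shadow over all `C.erase a` gives `k * ∑ l ∈ C, c l`. The same sum is `(k
    -- + 1) h C + swapSum G h C = k(|G| - k - 1) h C`.
    refine ⟨fun l => k * c l / (k * (G.card - k - 1)), fun C hC hCk => ?_⟩
    have h1 := sum_shadowSum_erase hC h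
    rw [hh C hC hCk, hCk] at h1
    have h2 : ∑ a ∈ C, shadowSum G h (C.erase a) = k * ∑ l ∈ C, c l := by
      have : ∀ a ∈ C, shadowSum G h (C.erase a) = ∑ l ∈ C, c l - c a := by
        intro a ha
        rw [hc _ ((erase_subset _ _).trans hC) (by rw [card_erase_of_mem ha, hCk]; rfl),
          ← add_sum_erase _ _ ha]
        ring
      rw [sum_congr rfl this, sum_sub_distrib, sum_const, nsmul_eq_mul, hCk]
      push_cast
      ring
    rw [← sum_div, ← mul_sum, eq_div_iff hpos, ← h2, h1]
    push_cast
    ring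

/-- A linear function that vanishes on all `k`-subsets of `G` is zero. -/
theorem eq_zero_of_sum_eq_zero {G : Finset α} {k : ℕ} (hk : 1 ≤ k) (hkG : k < G.card)
    {w : α → ℚ} (hw : ∀ C ⊆ G, C.card = k → ∑ l ∈ C, w l = 0) : ∀ l ∈ G, w l = 0 := by
  have heq : ∀ l ∈ G, ∀ m ∈ G, w l = w m := by
    intro l hl m hm
    by_cases hlm : l = m
    · rw [hlm]
    have hm' : m ∈ G.erase l := mem_erase.2 ⟨Ne.symm hlm, hm⟩
    obtain ⟨D, hD, hDk⟩ := exists_subset_card_eq (s := (G.erase l).erase m) (n := k - 1) (by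
      rw [card_erase_of_mem hm', card_erase_of_mem hl]; omega)
    have hlD : l ∉ D := fun h => by simpa using hD h
    have hmD : m ∉ D := fun h => by simpa using hD h
    have hDG : D ⊆ G := hD.trans ((erase_subset _ _).trans (erase_subset _ _))
    have h1 := hw (insert l D) (insert_subset hl hDG)
      (by rw [card_insert_of_notMem hlD]; omega)
    have h2 := hw (insert m D) (insert_subset hm hDG)
      (by rw [card_insert_of_notMem hmD]; omega)
    rw [sum_insert hlD] at h1
    rw [sum_insert hmD] at h2
    linarith
  intro l hl
  obtain ⟨C, hC, hCk⟩ := exists_subset_card_eq (s := G) (n := k) hkG.le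
  have h1 := hw C hC hCk
  rw [sum_congr rfl fun m hm => heq m (hC hm) l hl, sum_const, nsmul_eq_mul, hCk] at h1
  have : (k : ℚ) ≠ 0 := by exact_mod_cast (by omega : k ≠ 0)
  simpa [this] using h1

/-- If the off-diagonal part of `c` sums to zero over all squares of `e`-subsets, then the
off-diagonal part of `c` is skew-symmetric. -/
theorem skew_of_sum_eq_zero {Y : Finset α} {e : ℕ} (he : 2 ≤ e) (heY : e + 2 ≤ Y.card)
    {c : α → α → ℚ} (hc : ∀ x ⊆ Y, x.card = e → ∑ i ∈ x, ∑ l ∈ x.erase i, c i l = 0) :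
    ∀ i ∈ Y, ∀ l ∈ Y, i ≠ l → c i l + c l i = 0 := by
  -- Replacing `p` by `q` in an `e`-set `insert p E` changes the double sum by a linear function of
  -- `E`. It vanishes on all `(e - 1)`-subsets avoiding `p` and `q`, so its coefficients are zero.
  -- Thus `c i l + c l i` is independent of the pair.
  have hstep : ∀ p ∈ Y, ∀ q ∈ Y, p ≠ q → ∀ i ∈ Y, i ≠ p → i ≠ q →
      c i p + c p i = c i q + c q i := by
    intro p hp q hq hpq i hi hip hiq
    have hq' : q ∈ Y.erase p := mem_erase.2 ⟨hpq.symm, hq⟩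
    have hexp : ∀ (r : α) (E : Finset α), r ∉ E → ∑ i ∈ insert r E, ∑ l ∈ (insert r E).erase i, c i l =
        ∑ i ∈ E, (c i r + c r i) + ∑ i ∈ E, ∑ l ∈ E.erase i, c i l := by
      intro r E hr
      have : ∀ i ∈ E, ∑ l ∈ (insert r E).erase i, c i l = c i r + ∑ l ∈ E.erase i, c i l := by
        intro i hi
        rw [erase_insert_of_ne (ne_of_mem_of_not_mem hi hr).symm,
          sum_insert (fun h => hr (mem_of_mem_erase h))]
      rw [sum_insert hr, erase_insert hr, sum_congr rfl this, sum_add_distrib, sum_add_distrib]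
      ring
    have h0 := eq_zero_of_sum_eq_zero (G := (Y.erase p).erase q) (k := e - 1)
      (w := fun i => (c i p + c p i) - (c i q + c q i)) (by omega)
      (by rw [card_erase_of_mem hq', card_erase_of_mem hp]; omega) (by
        intro E hE hEk
        have hpE : p ∉ E := fun h => by simpa using hE h
        have hqE : q ∉ E := fun h => by simpa using hE h
        have hEY : E ⊆ Y := hE.trans ((erase_subset _ _).trans (erase_subset _ _))
        have h1 := hc (insert p E) (insert_subset hp hEY)
          (by rw [card_insert_of_notMem hpE]; omega)
        have h2 := hc (insert q E) (insert_subset hq hEY)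
          (by rw [card_insert_of_notMem hqE]; omega)
        rw [hexp p E hpE] at h1
        rw [hexp q E hqE] at h2
        rw [sum_sub_distrib]
        linarith) i (by simp [*])
    linarith
  intro i hi l hl hil
  have hall : ∀ p ∈ Y, ∀ q ∈ Y, p ≠ q → c p q + c q p = c i l + c l i := by
    intro p hp q hq hpq
    by_cases hpi : p = i
    · subst hpi
      by_cases hql : q = l
      · rw [hql]
      · exact hstep q hq l hl hql p hp hpq hil
    · by_cases hqi : q = i
      · subst hqi
        by_cases hpl : p = l
        · subst hpl; ring
        · linarith [hstep p hp l hl hpl q hq hpq.symm hil]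
      · have h1 := hstep p hp i hi hpi q hq hpq.symm hqi
        by_cases hql : q = l
        · subst hql; linarith
        · linarith [hstep q hq l hl hql i hi (Ne.symm hqi) hil]
  obtain ⟨x, hx, hxe⟩ := exists_subset_card_eq (s := Y) (n := e) (by omega)
  have h1 := hc x hx hxe
  have h2 : ∑ i ∈ x, ∑ l ∈ x.erase i, c l i = ∑ i ∈ x, ∑ l ∈ x.erase i, c i l := by
    refine sum_comm' fun a b => ?_
    simp only [mem_erase]
    tauto
  have h3 : ∑ p ∈ x, ∑ q ∈ x.erase p, (c i l + c l i) = 0 := by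
    rw [← sum_congr rfl fun p hp => sum_congr rfl fun q hq =>
      hall p (hx hp) q (hx (mem_of_mem_erase hq)) (ne_of_mem_erase hq).symm]
    simp only [sum_add_distrib]
    rw [h2, h1, add_zero]
  have h4 : ∀ p ∈ x, ∑ q ∈ x.erase p, (c i l + c l i) = (e - 1 : ℕ) * (c i l + c l i) := by
    intro p hp
    rw [sum_const, nsmul_eq_mul, card_erase_of_mem hp, hxe]
  rw [sum_congr rfl h4, sum_const, nsmul_eq_mul, hxe] at h3
  have h5 : ((e - 1 : ℕ) : ℚ) ≠ 0 := by exact_mod_cast (by omega : e - 1 ≠ 0)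
  have h6 : (e : ℚ) ≠ 0 := by exact_mod_cast (by omega : e ≠ 0)
  simpa [h5, h6] using h3

/-- A linear function with values `±1` on the `k`-subsets of `G` has constant coefficients with
at most one exception. -/
theorem exists_const_of_sum_eq_one_or_neg_one {G : Finset α} {k : ℕ} (hk : 2 ≤ k) (hkG : k + 2 ≤ G.card)
    {c : α → ℚ} (hc : ∀ C ⊆ G, C.card = k → ∑ l ∈ C, c l = 1 ∨ ∑ l ∈ C, c l = -1) :
    ∃ t : ℚ, ∃ l₀ : α, ((k * t = 1 ∨ k * t = -1) ∧ ∀ l ∈ G, l ≠ l₀ → c l = t) ∧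
      ∀ l ∈ G, (k * c l = 1 ∨ k * c l = -1) → c l = t := by
  have hdiff : ∀ l ∈ G, ∀ m ∈ G, c l = c m ∨ c l = c m + 2 ∨ c l = c m - 2 := by
    intro l hl m hm
    by_cases hlm : l = m
    · simp [hlm]
    have hm' : m ∈ G.erase l := mem_erase.2 ⟨Ne.symm hlm, hm⟩
    obtain ⟨D, hD, hDk⟩ := exists_subset_card_eq (s := (G.erase l).erase m) (n := k - 1) (by
      rw [card_erase_of_mem hm', card_erase_of_mem hl]; omega)
    have hlD : l ∉ D := fun h => by simpa using hD h
    have hmD : m ∉ D := fun h => by simpa using hD h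
    have hDG : D ⊆ G := hD.trans ((erase_subset _ _).trans (erase_subset _ _))
    have h1 := hc (insert l D) (insert_subset hl hDG)
      (by rw [card_insert_of_notMem hlD]; omega)
    have h2 := hc (insert m D) (insert_subset hm hDG)
      (by rw [card_insert_of_notMem hmD]; omega)
    rw [sum_insert hlD] at h1
    rw [sum_insert hmD] at h2
    rcases h1 with h1 | h1 <;> rcases h2 with h2 | h2
    · left; linarith
    · right; left; linarith
    · right; right; linarith
    · left; linarith
  -- Exchanging two disjoint pairs at once would change the sum by 4, but two values `± 1` differ by
  -- at most 2. Hence the larger or the smaller coefficient value occurs only once.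
  have hdiff2 : ∀ l ∈ G, ∀ l' ∈ G, ∀ m ∈ G, ∀ m' ∈ G, l ≠ l' → m ≠ m' → l ≠ m → l ≠ m' →
      l' ≠ m → l' ≠ m' → c l + c l' ≠ c m + c m' + 4 := by
    intro l hl l' hl' m hm m' hm' h1 h2 h3 h4 h5 h6 hcon
    obtain ⟨D, hD, hDk⟩ := exists_subset_card_eq (s := G \ {l, l', m, m'}) (n := k - 2) (by
      have : ({l, l', m, m'} : Finset α).card = 4 := by
        rw [card_insert_of_notMem (by simp [*]), card_insert_of_notMem (by simp [*]),
          card_pair h2]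
      have := le_card_sdiff {l, l', m, m'} G
      omega)
    have hDG : D ⊆ G := hD.trans sdiff_subset
    have g1 : l ∉ D := fun h => by simpa using hD h
    have g2 : l' ∉ D := fun h => by simpa using hD h
    have g3 : m ∉ D := fun h => by simpa using hD h
    have g4 : m' ∉ D := fun h => by simpa using hD h
    have e1 := hc (insert l (insert l' D)) (insert_subset hl (insert_subset hl' hDG))
      (by rw [card_insert_of_notMem (by simp [*]), card_insert_of_notMem g2]; omega)
    have e2 := hc (insert m (insert m' D)) (insert_subset hm (insert_subset hm' hDG))
      (by rw [card_insert_of_notMem (by simp [*]), card_insert_of_notMem g4]; omega)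
    rw [sum_insert (by simp [*]), sum_insert g2] at e1
    rw [sum_insert (by simp [*]), sum_insert g4] at e2
    rcases e1 with e1 | e1 <;> rcases e2 with e2 | e2 <;> linarith
  obtain ⟨t, l₀, htl⟩ : ∃ t : ℚ, ∃ l₀ : α, ∀ l ∈ G, l ≠ l₀ → c l = t := by
    by_cases hcst : ∀ l ∈ G, ∀ m ∈ G, c l = c m
    · obtain ⟨m, hm⟩ := card_pos.1 (by omega : 0 < G.card)
      exact ⟨c m, m, fun l hl _ => hcst l hl m hm⟩
    push Not at hcst
    obtain ⟨l, m, hl, hm, hlm⟩ : ∃ l m, l ∈ G ∧ m ∈ G ∧ c l = c m + 2 := by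
      obtain ⟨l, hl, m, hm, hlm⟩ := hcst
      rcases hdiff l hl m hm with h | h | h
      · exact absurd h hlm
      · exact ⟨l, m, hl, hm, h⟩
      · exact ⟨m, l, hm, hl, by linarith⟩
    have hne : l ≠ m := by rintro rfl; linarith
    have htwo : ∀ r ∈ G, c r = c m ∨ c r = c l := by
      intro r hr
      rcases hdiff r hr m hm with h | h | h
      · exact Or.inl h
      · right; linarith
      · exfalso
        rcases hdiff r hr l hl with h' | h' | h' <;> linarith
    by_cases hall : ∀ r ∈ G, r ≠ l → c r = c m
    · exact ⟨c m, l, hall⟩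
    · push Not at hall
      obtain ⟨r, hr, hrl, hrm⟩ := hall
      have hr1 : c r = c l := (htwo r hr).resolve_left hrm
      refine ⟨c l, m, fun s hs hsm => ?_⟩
      by_contra hsl
      have hs1 := (htwo s hs).resolve_right hsl
      refine hdiff2 l hl r hr m hm s hs hrl.symm (Ne.symm hsm) hne ?_ ?_ ?_ (by linarith)
      · rintro rfl; exact hsl rfl
      · rintro rfl; exact hrm rfl
      · rintro rfl; exact hsl hr1
  have hkt : k * t = 1 ∨ k * t = -1 := by
    obtain ⟨C, hC, hCk⟩ := exists_subset_card_eq (s := G.erase l₀) (n := k) (by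
      have := pred_card_le_card_erase (s := G) (a := l₀)
      omega)
    have := hc C (hC.trans (erase_subset _ _)) hCk
    rwa [sum_congr rfl fun l hl => htl l (mem_of_mem_erase (hC hl)) (ne_of_mem_erase (hC hl)),
      sum_const, nsmul_eq_mul, hCk] at this
  refine ⟨t, l₀, ⟨hkt, htl⟩, fun l hl hkl => ?_⟩
  obtain ⟨m, hm⟩ := card_pos.1 (by
    have := pred_card_le_card_erase (s := G) (a := l₀)
    omega : 0 < (G.erase l₀).card)
  have hmt := htl m (mem_of_mem_erase hm) (ne_of_mem_erase hm)
  have hk2 : (2 : ℚ) ≤ k := by exact_mod_cast hk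
  -- A coefficient different from `t` is off by exactly 2, while two numbers in `{1/k, -1/k}` differ
  -- by at most `2/k ≤ 1`.
  rcases hdiff l hl m (mem_of_mem_erase hm) with h | h | h
  · rw [h, hmt]
  all_goals
    exfalso
    rw [h, hmt] at hkl
    rcases hkt with h1 | h1 <;> rcases hkl with h2 | h2 <;> linarith

end Slice

/-! ### Signings of the Johnson graph -/

section Signing

open Finset

variable {α : Type*} [DecidableEq α]

/-- The indicator function of the sets that separate `i` and `j`. -/
def separates (i j : α) (x : Finset α) : ℚ :=
  if (i ∈ x ↔ j ∈ x) then 0 else 1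

theorem separates_comm (i j : α) : separates i j = separates j i := by
  funext x
  simp only [separates, iff_comm]

theorem card_swap {x : Finset α} {a b : α} (ha : a ∈ x) (hb : b ∉ x) :
    (insert b (x.erase a)).card = x.card := by
  rw [card_insert_of_notMem (fun h => hb (mem_of_mem_erase h)), card_erase_add_one ha]

/-- The behaviour of `separates i j` along the steps from a set that separates `i` and `j`. -/
theorem separates_swap {i j : α} {x : Finset α} (hi : i ∈ x) (hj : j ∉ x) {a b : α} (hb : b ∉ x) (ha : a ∈ x) :
    separates i j (insert b (x.erase a)) = 1 - (if a = i then 1 else 0) - (if b = j then 1 else 0)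
      + 2 * ((if a = i then 1 else 0) * if b = j then 1 else 0) := by
  have h1 : i ≠ b := ne_of_mem_of_not_mem hi hb
  have h2 : j ≠ a := (ne_of_mem_of_not_mem ha hj).symm
  have h3 : j ≠ i := (ne_of_mem_of_not_mem hi hj).symm
  by_cases h : a = i
  · subst h
    by_cases h' : b = j
    · subst h'; simp [separates, *]; norm_num
    · simp [separates, *, Ne.symm h']
  · by_cases h' : b = j
    · subst h'; simp [separates, *, Ne.symm h]
    · simp [separates, *, Ne.symm h, Ne.symm h']

variable [Fintype α]

/-- The signed adjacency operator: `M x a b` is the sign of the step from `x` to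
`(x \ {a}) ∪ {b}`. -/
def signedSum (M : Finset α → α → α → ℚ) (f : Finset α → ℚ) (x : Finset α) : ℚ :=
  ∑ a ∈ x, ∑ b ∈ xᶜ, M x a b * f (insert b (x.erase a))

/-- A skew-symmetric signing of the edges of the Johnson graph on the `e`-subsets of `α` with the
local regularity that comes from a scheme. -/
structure IsRegularSigning (e : ℕ) (M : Finset α → α → α → ℚ) : Prop where
  sign : ∀ x, x.card = e → ∀ a ∈ x, ∀ b ∉ x, M x a b = 1 ∨ M x a b = -1
  skew : ∀ x, x.card = e → ∀ a ∈ x, ∀ b ∉ x, M (insert b (x.erase a)) b a = -M x a b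
  total : ∀ x, x.card = e → ∑ a ∈ x, ∑ b ∈ xᶜ, M x a b = 0
  -- Here `p - q` is the signed count over common neighbours. The summand 2 appears because the
  -- entry `(a, b)` itself is counted once in its row and once in its column.
  cross : ∃ p q : ℕ, 1 ≤ q ∧ 3 * p + q + 2 = Fintype.card α ∧
    ∀ x, x.card = e → ∀ a ∈ x, ∀ b ∉ x,
      ∑ b' ∈ xᶜ, M x a b' + ∑ a' ∈ x, M x a' b = ((p : ℚ) - q + 2) * M x a b
  comm : ∀ i j x, x.card = e → signedSum M (swapSum univ (separates i j)) x =
    swapSum univ (signedSum M (separates i j)) x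

/-! ### Nonexistence of regular signings for `e ≥ 3` -/

namespace IsRegularSigning

variable {e : ℕ} {M : Finset α → α → α → ℚ}

theorem card_compl_cast (hcard : 2 * e ≤ Fintype.card α) {x : Finset α} (hx : x.card = e) :
    ((xᶜ).card : ℚ) = (Fintype.card α : ℚ) - e := by
  rw [card_compl, hx, Nat.cast_sub (by omega)]

/-- If the signs do not depend on the removed element, there is a contradiction in a clique. -/
theorem not_const (hM : IsRegularSigning e M) (he : 2 ≤ e) (hcard : 2 * e ≤ Fintype.card α) :
    ¬ ∀ x, x.card = e → ∀ a ∈ x, ∀ a' ∈ x, ∀ b ∉ x, M x a b = M x a' b := by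
  intro hconst
  obtain ⟨x, -, hx⟩ := exists_subset_card_eq (s := (univ : Finset α)) (n := e)
    (by rw [card_univ]; omega)
  obtain ⟨a, ha, a', ha', haa⟩ := one_lt_card.1 (by omega : 1 < x.card)
  obtain ⟨b, hb⟩ := card_pos.1 (by rw [card_compl]; omega : 0 < (xᶜ).card)
  rw [mem_compl] at hb
  have hab : a ≠ b := by rintro rfl; exact hb ha
  have hab' : a' ≠ b := by rintro rfl; exact hb ha'
  -- The sets `x`, `x - a + b` and `x - a' + b` form a triangle. The assumption, applied at each
  -- corner, makes every corner a source or a sink of the triangle, which no orientation allows.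
  have h0 := hconst x hx a ha a' ha' b hb
  have h1 := hconst (insert b (x.erase a)) ((card_swap ha hb).trans hx) b (by simp) a'
    (by simp [*, haa.symm]) a (by simp [hab])
  have h2 := hconst (insert b (x.erase a')) ((card_swap ha' hb).trans hx) b (by simp) a
    (by simp [*]) a' (by simp [hab'])
  have h3 := hM.skew x hx a ha b hb
  have h4 := hM.skew x hx a' ha' b hb
  have h5 := hM.skew (insert b (x.erase a)) ((card_swap ha hb).trans hx) a'
    (by simp [*, haa.symm]) a (by simp [hab])
  have h6 : insert a ((insert b (x.erase a)).erase a') = insert b (x.erase a') := by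
    ext z
    simp only [mem_insert, mem_erase]
    by_cases hz : z = a
    · subst hz; simp_all
    · by_cases hz' : z = b
      · subst hz'; simp [hab'.symm]
      · simp [hz, hz']
  rw [h6] at h5
  have h7 : M x a b = 0 := by linarith
  rcases hM.sign x hx a ha b hb with h | h <;> rw [h] at h7 <;> norm_num at h7

/-- Summing `cross` along a row or a column and using `total` shows that each row sum is multiplied
by `n - e` and by `μ` with the same result, and each column sum by `e` and by `μ`. -/
theorem row_col_eq_zero (hM : IsRegularSigning e M) (he : 2 ≤ e)
    (hcard : 2 * e ≤ Fintype.card α) :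
    (∀ x, x.card = e → ∀ a ∈ x, ∑ b ∈ xᶜ, M x a b = 0) ∧
      (∀ x, x.card = e → ∀ b ∉ x, ∑ a ∈ x, M x a b = 0) := by
  obtain ⟨p, q, hq, hpq, hcross⟩ := hM.cross
  set μ : ℚ := (p : ℚ) - q + 2 with hμ
  have hrow : ∀ x, x.card = e → ∀ a ∈ x,
      ((Fintype.card α : ℚ) - e) * ∑ b ∈ xᶜ, M x a b = μ * ∑ b ∈ xᶜ, M x a b := by
    intro x hx a ha
    have h := sum_congr (rfl : xᶜ = xᶜ) fun b hb => hcross x hx a ha b (mem_compl.1 hb)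
    rw [sum_add_distrib, sum_const, nsmul_eq_mul, sum_comm, hM.total x hx, ← mul_sum,
      card_compl_cast hcard hx] at h
    linarith
  have hcol : ∀ x, x.card = e → ∀ b ∉ x,
      (e : ℚ) * ∑ a ∈ x, M x a b = μ * ∑ a ∈ x, M x a b := by
    intro x hx b hb
    have h := sum_congr (rfl : x = x) fun a ha => hcross x hx a ha b hb
    rw [sum_add_distrib, sum_const, nsmul_eq_mul, hM.total x hx, ← mul_sum, hx] at h
    linarith
  have hcard' : (2 : ℚ) * e ≤ Fintype.card α := by exact_mod_cast hcard
  have hpq' : (3 : ℚ) * p + q + 2 = Fintype.card α := by exact_mod_cast hpq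
  have hq' : (1 : ℚ) ≤ q := by exact_mod_cast hq
  have he' : (2 : ℚ) ≤ e := by exact_mod_cast he
  -- Since `q ≥ 1`, `μ = (n + 4 - 4q) / 3 ≤ n / 3 < n / 2 ≤ n - e`, where `n = Fintype.card α`.
  have hμv : (Fintype.card α : ℚ) - e ≠ μ := by
    intro h
    rw [hμ] at h
    linarith
  have hR : ∀ x, x.card = e → ∀ a ∈ x, ∑ b ∈ xᶜ, M x a b = 0 := by
    intro x hx a ha
    by_contra h0
    exact hμv (mul_right_cancel₀ h0 (hrow x hx a ha))
  refine ⟨hR, fun x hx b hb => ?_⟩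
  by_contra h0
  -- A nonzero column sum forces `μ = e ≠ 0`. With zero row sums, `cross` then says that each entry
  -- is its column sum divided by `μ`, so it does not depend on the removed element.
  have hμu : (e : ℚ) = μ := mul_right_cancel₀ h0 (hcol x hx b hb)
  refine hM.not_const he hcard fun y hy a ha a' ha' b hb => ?_
  have h1 := hcross y hy a ha b hb
  have h2 := hcross y hy a' ha' b hb
  rw [hR y hy a ha] at h1
  rw [hR y hy a' ha'] at h2
  have hμ0 : μ ≠ 0 := by rw [← hμu]; positivity
  exact mul_left_cancel₀ hμ0 (by linarith)

/-- All row and column sums of the local sign matrices vanish. -/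
def Balanced (e : ℕ) (M : Finset α → α → α → ℚ) : Prop :=
  (∀ x, x.card = e → ∀ a ∈ x, ∑ b ∈ xᶜ, M x a b = 0) ∧
    (∀ x, x.card = e → ∀ b ∉ x, ∑ a ∈ x, M x a b = 0)

section Balanced

variable {i j : α} {x : Finset α}

theorem signedSum_congr {F : α → α → ℚ} {f : Finset α → ℚ}
    (h : ∀ a ∈ x, ∀ b ∉ x, f (insert b (x.erase a)) = F a b) :
    signedSum M f x = ∑ a ∈ x, ∑ b ∈ xᶜ, M x a b * F a b :=
  sum_congr rfl fun a ha => sum_congr rfl fun b hb => by rw [h a ha b (mem_compl.1 hb)]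

theorem sum_row (hB : Balanced e M) (hx : x.card = e) (i : α) :
    ∑ a ∈ x, ∑ b ∈ xᶜ, M x a b * (if a = i then 1 else 0) = 0 := by
  refine sum_eq_zero fun a ha => ?_
  split_ifs
  · simpa using hB.1 x hx a ha
  · simp

theorem sum_col (hB : Balanced e M) (hx : x.card = e) (j : α) :
    ∑ a ∈ x, ∑ b ∈ xᶜ, M x a b * (if b = j then 1 else 0) = 0 := by
  rw [sum_comm]
  refine sum_eq_zero fun b hb => ?_
  split_ifs
  · simpa using hB.2 x hx b (mem_compl.1 hb)
  · simp

theorem sum_all (hB : Balanced e M) (hx : x.card = e) :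
    ∑ a ∈ x, ∑ b ∈ xᶜ, M x a b * 1 = 0 :=
  sum_eq_zero fun a ha => by simpa using hB.1 x hx a ha

theorem signedSum_mem (hB : Balanced e M) (hx : x.card = e) (i : α) :
    signedSum M (fun y => if i ∈ y then 1 else 0) x = 0 := by
  by_cases hi : i ∈ x
  · rw [signedSum_congr (F := fun a _ => 1 - if a = i then 1 else 0)]
    · simp only [mul_sub, sum_sub_distrib]
      rw [sum_row hB hx, sum_all hB hx, sub_zero]
    · intro a ha b hb
      have : i ≠ b := ne_of_mem_of_not_mem hi hb
      by_cases h : a = i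
      · simp [h, this]
      · simp [h, hi, Ne.symm h]
  · rw [signedSum_congr (F := fun _ b => if b = i then 1 else 0)]
    · exact sum_col hB hx i
    · intro a ha b hb
      by_cases h : b = i
      · simp [h]
      · simp [h, hi, Ne.symm h]

theorem signedSum_separates_of_mem_of_mem (hB : Balanced e M) (hx : x.card = e) (hij : i ≠ j)
    (hi : i ∈ x) (hj : j ∈ x) : signedSum M (separates i j) x = 0 := by
  rw [signedSum_congr (F := fun a _ => (if a = i then 1 else 0) + if a = j then 1 else 0)]
  · simp only [mul_add, sum_add_distrib]
    rw [sum_row hB hx, sum_row hB hx, add_zero]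
  · intro a ha b hb
    have h1 : i ≠ b := ne_of_mem_of_not_mem hi hb
    have h2 : j ≠ b := ne_of_mem_of_not_mem hj hb
    by_cases h : a = i
    · subst h; simp [separates, *, hij.symm]
    · by_cases h' : a = j
      · subst h'; simp [separates, *]
      · simp [separates, *, Ne.symm h, Ne.symm h']

theorem signedSum_separates_of_notMem_of_notMem (hB : Balanced e M) (hx : x.card = e)
    (hij : i ≠ j) (hi : i ∉ x) (hj : j ∉ x) : signedSum M (separates i j) x = 0 := by
  rw [signedSum_congr (F := fun _ b => (if b = i then 1 else 0) + if b = j then 1 else 0)]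
  · simp only [mul_add, sum_add_distrib]
    rw [sum_col hB hx, sum_col hB hx, add_zero]
  · intro a ha b hb
    by_cases h : b = i
    · subst h; simp [separates, *, hij.symm]
    · by_cases h' : b = j
      · subst h'; simp [separates, *]
      · simp [separates, *, Ne.symm h, Ne.symm h']

/-- Of the expansion in `separates_swap`, balance kills everything except the product term, which
picks out the exchange of `i` and `j`. -/
theorem signedSum_separates_of_mem_of_notMem (hB : Balanced e M) (hx : x.card = e)
    (hi : i ∈ x) (hj : j ∉ x) : signedSum M (separates i j) x = 2 * M x i j := by
  rw [signedSum_congr fun a ha b hb => separates_swap hi hj hb ha]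
  simp only [mul_add, mul_sub, sum_add_distrib, sum_sub_distrib]
  rw [sum_row hB hx, sum_col hB hx, sum_all hB hx]
  have : ∑ a ∈ x, ∑ b ∈ xᶜ, M x a b * (2 * ((if a = i then 1 else 0) * if b = j then 1 else 0))
      = 2 * M x i j := by
    rw [sum_eq_single i, sum_eq_single j]
    · simp; ring
    · intro b _ hb; simp [hb]
    · intro h; simp [hj] at h
    · intro a _ ha; simp [ha]
    · intro h; exact absurd hi h
  rw [this]
  ring

end Balanced

/-- The coefficient of `separates i j x` is the eigenvalue `θ₂` of `J(n, e)`. The other terms are a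
constant and indicators of single elements, which a balanced signing annihilates. -/
theorem swapSum_separates (hcard : 2 * e ≤ Fintype.card α) {i j : α} (hij : i ≠ j)
    {x : Finset α} (hx : x.card = e) :
    swapSum univ (separates i j) x = 2 * e +
      (((e : ℚ) - 2) * (Fintype.card α - e - 2) - 2) * separates i j x +
      ((Fintype.card α : ℚ) - 2 * e) *
        ((if i ∈ x then 1 else 0) + if j ∈ x then 1 else 0) := by
  have hs : swapSum univ (separates i j) x =
      signedSum (fun _ _ _ => 1) (separates i j) x := by
    simp [swapSum, signedSum, compl_eq_univ_sdiff]
  have hsep : ∀ {i j : α}, i ∈ x → j ∉ x → signedSum (fun _ _ _ => 1) (separates i j) x =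
      ((e : ℚ) - 1) * (Fintype.card α - e - 1) + 1 := by
    intro i j hi hj
    rw [signedSum_congr fun a ha b hb => separates_swap hi hj hb ha]
    simp only [one_mul, sum_add_distrib, sum_sub_distrib, ← mul_sum, ← sum_mul]
    simp only [sum_ite_eq', hi, hj, mem_compl, not_false_eq_true, if_true, sum_const,
      nsmul_eq_mul, card_compl_cast hcard hx, hx, ← mul_sum]
    ring
  rw [hs]
  by_cases hi : i ∈ x <;> by_cases hj : j ∈ x
  · rw [signedSum_congr (F := fun a _ => (if a = i then 1 else 0) + if a = j then 1 else 0)]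
    · simp only [one_mul, sum_add_distrib, sum_const, nsmul_eq_mul, ← mul_sum,
        card_compl_cast hcard hx, sum_ite_eq', hi, hj]
      simp [separates, hi, hj]
      ring
    · intro a ha b hb
      have h1 : i ≠ b := ne_of_mem_of_not_mem hi hb
      have h2 : j ≠ b := ne_of_mem_of_not_mem hj hb
      by_cases h : a = i
      · subst h; simp [separates, *, hij.symm]
      · by_cases h' : a = j
        · subst h'; simp [separates, *]
        · simp [separates, *, Ne.symm h, Ne.symm h']
  · rw [hsep hi hj]
    simp [separates, hi, hj]
    ring
  · rw [separates_comm, hsep hj hi]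
    simp [separates, hi, hj]
    ring
  · rw [signedSum_congr (F := fun _ b => (if b = i then 1 else 0) + if b = j then 1 else 0)]
    · simp only [one_mul, sum_add_distrib, sum_const, nsmul_eq_mul, hx, sum_ite_eq', hi, hj,
        mem_compl, not_false_eq_true, if_true]
      simp [separates, hi, hj]
      ring
    · intro a ha b hb
      by_cases h : b = i
      · subst h; simp [separates, *, hij.symm]
      · by_cases h' : b = j
        · subst h'; simp [separates, *]
        · simp [separates, *, Ne.symm h, Ne.symm h']

theorem swapSum_signedSum_separates (hM : IsRegularSigning e M) (hB : Balanced e M)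
    (hcard : 2 * e ≤ Fintype.card α) {i j : α} (hij : i ≠ j) {x : Finset α} (hx : x.card = e) :
    swapSum univ (signedSum M (separates i j)) x =
      (((e : ℚ) - 2) * (Fintype.card α - e - 2) - 2) * signedSum M (separates i j) x := by
  rw [← hM.comm i j x hx, signedSum_congr fun a ha b hb =>
    swapSum_separates hcard hij ((card_swap ha hb).trans hx)]
  have h1 := sum_all hB hx
  have h2 := signedSum_mem hB hx i
  have h3 := signedSum_mem hB hx j
  simp only [signedSum] at h2 h3 ⊢
  have h4 : ∀ a b, M x a b * (2 * (e : ℚ) + (((e : ℚ) - 2) * (Fintype.card α - e - 2) - 2) *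
        separates i j (insert b (x.erase a)) + ((Fintype.card α : ℚ) - 2 * e) *
        ((if i ∈ insert b (x.erase a) then 1 else 0) +
          if j ∈ insert b (x.erase a) then 1 else 0)) =
      2 * (e : ℚ) * (M x a b * 1) + (((e : ℚ) - 2) * (Fintype.card α - e - 2) - 2) *
        (M x a b * separates i j (insert b (x.erase a))) + ((Fintype.card α : ℚ) - 2 * e) *
        (M x a b * (if i ∈ insert b (x.erase a) then 1 else 0)) +
        ((Fintype.card α : ℚ) - 2 * e) *
        (M x a b * (if j ∈ insert b (x.erase a) then 1 else 0)) := by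
    intro a b; ring
  simp only [h4, sum_add_distrib, ← mul_sum]
  rw [h1, h2, h3]
  ring

/-- As a function of the remaining elements, the sign of the exchange of `i` and `j` is an
eigenfunction of a smaller Johnson graph. -/
theorem swapSum_sign (hM : IsRegularSigning e M) (hB : Balanced e M)
    (hcard : 2 * e ≤ Fintype.card α) {i j : α} (hij : i ≠ j) {C : Finset α}
    (hC : C ⊆ univ \ {i, j}) (hCe : C.card + 1 = e) :
    swapSum (univ \ {i, j}) (fun C => M (insert i C) i j) C =
      (((e : ℚ) - 2) * (Fintype.card α - e - 2) - 1) * M (insert i C) i j := by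
  have hi : i ∉ C := fun h => by simpa using hC h
  have hj : j ∉ C := fun h => by simpa using hC h
  have hx : (insert i C).card = e := by rw [card_insert_of_notMem hi, hCe]
  have hjx : j ∉ insert i C := by simp [hij.symm, hj]
  have hcompl : univ \ insert i C = insert j ((univ \ {i, j}) \ C) := by
    ext z
    simp only [mem_sdiff, mem_univ, true_and, mem_insert, mem_singleton]
    by_cases hz : z = j
    · subst hz; simp [hij.symm, hj]
    · simp [hz]
  -- Evaluate the eigenvalue equation at `insert i C`. Exchanging `i` for `j` contributes `-2 * M
  -- (insert i C) i j` by skewness, and this shifts the eigenvalue by one. Neighbours containing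
  -- both or neither of `i`, `j` contribute zero, and the rest are the exchanges inside `C`.
  have h := hM.swapSum_signedSum_separates hB hcard hij hx
  rw [signedSum_separates_of_mem_of_notMem hB hx (mem_insert_self _ _) hjx] at h
  rw [swapSum, sum_insert hi, erase_insert hi, hcompl, sum_insert (by simp)] at h
  have hjC : (insert j C).card = e := by rw [card_insert_of_notMem hj, hCe]
  have h1 : signedSum M (separates i j) (insert j C) = -(2 * M (insert i C) i j) := by
    have := hM.skew (insert i C) hx i (mem_insert_self _ _) j hjx
    rw [erase_insert hi] at this
    rw [separates_comm, signedSum_separates_of_mem_of_notMem hB hjC (mem_insert_self _ _)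
      (by simp [hij, hi]), this]
    ring
  have h2 : ∑ b ∈ (univ \ {i, j}) \ C, signedSum M (separates i j) (insert b C) = 0 := by
    refine sum_eq_zero fun b hb => ?_
    simp only [mem_sdiff, mem_univ, true_and, mem_insert, mem_singleton, not_or] at hb
    refine signedSum_separates_of_notMem_of_notMem hB ?_ hij ?_ ?_
    · rw [card_insert_of_notMem hb.2, hCe]
    · simp [hi, Ne.symm hb.1.1]
    · simp [hj, Ne.symm hb.1.2]
  have h3 : ∀ a ∈ C, ∑ b ∈ insert j ((univ \ {i, j}) \ C),
      signedSum M (separates i j) (insert b ((insert i C).erase a)) =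
        2 * ∑ b ∈ (univ \ {i, j}) \ C, M (insert i (insert b (C.erase a))) i j := by
    intro a ha
    have hai : a ≠ i := ne_of_mem_of_not_mem ha hi
    have haj : a ≠ j := ne_of_mem_of_not_mem ha hj
    have hcd : ∀ b ∉ insert i C, (insert b ((insert i C).erase a)).card = e := fun b hb =>
      (card_swap (mem_insert_of_mem ha) hb).trans hx
    rw [sum_insert (by simp), signedSum_separates_of_mem_of_mem hB (hcd j hjx) hij
      (by simp [hai.symm]) (by simp), zero_add, mul_sum]
    refine sum_congr rfl fun b hb => ?_
    simp only [mem_sdiff, mem_univ, true_and, mem_insert, mem_singleton, not_or] at hb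
    rw [signedSum_separates_of_mem_of_notMem hB (hcd b (by simp [hb])) (by simp [hai.symm])
      (by simp [Ne.symm hb.1.2, hj, hij.symm]), erase_insert_of_ne hai.symm, insert_comm]
  rw [h1, h2, sum_congr rfl h3, ← mul_sum] at h
  rw [swapSum]
  linarith

theorem exists_linear (hM : IsRegularSigning e M) (hB : Balanced e M) (he : 2 ≤ e)
    (hcard : 2 * e ≤ Fintype.card α) {i j : α} (hij : i ≠ j) :
    ∃ c : α → ℚ, ∀ C ⊆ univ \ {i, j}, C.card = e - 1 → M (insert i C) i j = ∑ l ∈ C, c l := by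
  have hG : (univ \ {i, j} : Finset α).card = Fintype.card α - 2 := by
    rw [card_sdiff_of_subset (subset_univ _), card_univ, card_pair hij]
  refine exists_linear_of_swapSum_eq (univ \ {i, j}) (e - 1) (by omega) (by omega)
    (fun C => M (insert i C) i j) fun C hC hCe => ?_
  rw [hM.swapSum_sign hB hcard hij hC (by omega), hG, Nat.cast_sub (by omega),
    Nat.cast_sub (by omega)]
  push_cast
  ring

theorem false_of_three_le (hM : IsRegularSigning e M) (he : 3 ≤ e)
    (hcard : 2 * e ≤ Fintype.card α) : False := by
  have hB : Balanced e M := hM.row_col_eq_zero (by omega) hcard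
  obtain ⟨j⟩ : Nonempty α := Fintype.card_pos_iff.1 (by omega)
  choose! c hc using fun i (hij : i ≠ j) => hM.exists_linear hB (by omega) hcard hij
  have hY : (univ.erase j).card = Fintype.card α - 1 := by
    rw [card_erase_of_mem (mem_univ _), card_univ]
  -- With `j` fixed, the column sum at `j` of `M x` is the off-diagonal double sum of `c` over `x`.
  have hskew := skew_of_sum_eq_zero (Y := univ.erase j) (e := e) (c := c) (by omega)
    (by omega) (by
      intro x hx hxe
      have hjx : j ∉ x := fun h => by simpa using hx h
      rw [← hB.2 x hxe j hjx]
      refine sum_congr rfl fun i hi => ?_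
      rw [← hc i (ne_of_mem_of_not_mem hi hjx) (x.erase i), insert_erase hi]
      · intro z hz
        have : z ≠ j := ne_of_mem_of_not_mem (mem_of_mem_erase hz) hjx
        simp [this, ne_of_mem_erase hz]
      · rw [card_erase_of_mem hi, hxe])
  have hcls := fun i (hij : i ≠ j) => exists_const_of_sum_eq_one_or_neg_one
    (G := univ \ {i, j}) (k := e - 1) (c := c i) (by omega)
    (by rw [card_sdiff_of_subset (subset_univ _), card_univ, card_pair hij]; omega) (by
      intro C hC hCe
      have hi : i ∉ C := fun h => by simpa using hC h
      have hj : j ∉ C := fun h => by simpa using hC h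
      rw [← hc i hij C hC hCe]
      refine hM.sign _ ?_ i (mem_insert_self _ _) j (by simp [Ne.symm hij, hj])
      rw [card_insert_of_notMem hi, hCe]; omega)
  choose! t l₀ ht using hcls
  -- There are at least `2e ≥ 6` elements, enough to avoid `j`, earlier choices and exceptional
  -- indices.
  have hpick : ∀ s : Finset α, s.card ≤ 5 → ∃ m, m ∉ s := by
    intro s hs
    by_contra hcon
    push Not at hcon
    have := card_le_card (fun m _ => hcon m : (univ : Finset α) ⊆ s)
    rw [card_univ] at this
    omega
  obtain ⟨i, hi⟩ := hpick {j} (by simp)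
  obtain ⟨l, hl⟩ := hpick {j, i, l₀ i} (card_le_three.trans (by omega))
  obtain ⟨m, hm⟩ := hpick {j, i, l, l₀ i, l₀ l} card_le_five
  simp only [mem_insert, mem_singleton, not_or] at hi hl hm
  -- Only `q ≠ l₀ p` is needed: skewness gives `c q p = -t p`, and since `(e - 1) * t p = ± 1`, this
  -- coefficient cannot be the exceptional one for `q`.
  have key : ∀ p q, p ≠ j → q ≠ j → p ≠ q → q ≠ l₀ p → t q = -t p := by
    intro p q hp hq hpq hql
    have h1 := (ht p hp).1.2 q (by simp [hq, Ne.symm hpq]) hql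
    have h2 := hskew p (by simp [hp]) q (by simp [hq]) hpq
    have h3 : c q p = -t p := by linarith
    have h4 := (ht q hq).2 p (by simp [hp, hpq]) (by
      rw [h3]
      rcases (ht p hp).1.1 with h | h
      · right; linarith
      · left; linarith)
    rw [← h4, h3]
  have h1 := key i l hi hl.1 (Ne.symm hl.2.1) hl.2.2
  have h2 := key i m hi hm.1 (Ne.symm hm.2.1) hm.2.2.2.1
  have h3 := key l m hl.1 hm.1 (Ne.symm hm.2.2.1) hm.2.2.2.2
  have h0 : t i = 0 := by linarith
  have := (ht i hi).1.1
  rw [h0] at this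
  norm_num at this

end IsRegularSigning

end Signing

/-! ### Orientations in which all arcs lie in equally many triangles -/

section Orientation

open Finset Matrix

open scoped Classical in
/-- The adjacency matrix of a digraph. -/
noncomputable def adjMat {V : Type*} (Γ : Digraph V) : Matrix V V ℚ :=
  Matrix.of fun x y => if Γ.Adj x y then 1 else 0

variable {V : Type*} {Γ : Digraph V}

theorem adjMat_of_adj {x y : V} (h : Γ.Adj x y) : adjMat Γ x y = 1 := by
  simp [adjMat, h]

theorem adjMat_of_not_adj {x y : V} (h : ¬ Γ.Adj x y) : adjMat Γ x y = 0 := by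
  simp [adjMat, h]

/-- The skew adjacency matrix of a digraph. -/
noncomputable def skewMat (Γ : Digraph V) : Matrix V V ℚ := adjMat Γ - (adjMat Γ)ᵀ

/-- The symmetrised adjacency matrix of a digraph. -/
noncomputable def symMat (Γ : Digraph V) : Matrix V V ℚ := adjMat Γ + (adjMat Γ)ᵀ

/-- `Γ` is asymmetric with normal adjacency matrix, and all of its arcs lie in the same numbers of
transitive and of cyclic triangles, the latter being positive. -/
structure IsTriangleRegular [Fintype V] (Γ : Digraph V) : Prop where
  asymm : ∀ x y, Γ.Adj x y → ¬ Γ.Adj y x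
  normal : adjMat Γ * (adjMat Γ)ᵀ = (adjMat Γ)ᵀ * adjMat Γ
  triangles : ∃ p q : ℕ, 1 ≤ q ∧ ∀ x y, Γ.Adj x y → (adjMat Γ * adjMat Γ) x y = p ∧
    (adjMat Γ * (adjMat Γ)ᵀ) x y = p ∧ ((adjMat Γ)ᵀ * (adjMat Γ)ᵀ) x y = q

namespace IsTriangleRegular

variable [Fintype V]

theorem loopless (hΓ : IsTriangleRegular Γ) (x : V) : ¬ Γ.Adj x x :=
  fun h => hΓ.asymm x x h h

theorem adj_iff (hΓ : IsTriangleRegular Γ) (x y : V) :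
    Γ.toSimpleGraphInclusive.Adj x y ↔ Γ.Adj x y ∨ Γ.Adj y x := by
  rw [Digraph.toSimpleGraphInclusive, SimpleGraph.fromRel_adj]
  refine ⟨fun h => h.2, fun h => ⟨?_, h⟩⟩
  rintro rfl
  exact hΓ.loopless x (or_self_iff.1 h)

theorem symMat_of_adj (hΓ : IsTriangleRegular Γ) {x y : V}
    (h : Γ.toSimpleGraphInclusive.Adj x y) : symMat Γ x y = 1 := by
  rcases (hΓ.adj_iff x y).1 h with h | h
  · simp [symMat, adjMat_of_adj h, adjMat_of_not_adj (hΓ.asymm _ _ h)]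
  · simp [symMat, adjMat_of_adj h, adjMat_of_not_adj (hΓ.asymm _ _ h)]

theorem symMat_of_not_adj (hΓ : IsTriangleRegular Γ) {x y : V}
    (h : ¬ Γ.toSimpleGraphInclusive.Adj x y) : symMat Γ x y = 0 := by
  rw [hΓ.adj_iff, not_or] at h
  simp [symMat, adjMat_of_not_adj h.1, adjMat_of_not_adj h.2]

theorem skewMat_of_adj (hΓ : IsTriangleRegular Γ) {x y : V}
    (h : Γ.toSimpleGraphInclusive.Adj x y) : skewMat Γ x y = 1 ∨ skewMat Γ x y = -1 := by
  rcases (hΓ.adj_iff x y).1 h with h | h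
  · simp [skewMat, adjMat_of_adj h, adjMat_of_not_adj (hΓ.asymm _ _ h)]
  · simp [skewMat, adjMat_of_adj h, adjMat_of_not_adj (hΓ.asymm _ _ h)]

theorem skewMat_of_not_adj (hΓ : IsTriangleRegular Γ) {x y : V}
    (h : ¬ Γ.toSimpleGraphInclusive.Adj x y) : skewMat Γ x y = 0 := by
  rw [hΓ.adj_iff, not_or] at h
  simp [skewMat, adjMat_of_not_adj h.1, adjMat_of_not_adj h.2]

theorem skewMat_mul_symMat_comm (hΓ : IsTriangleRegular Γ) :
    skewMat Γ * symMat Γ = symMat Γ * skewMat Γ := by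
  simp only [skewMat, symMat, add_mul, sub_mul, mul_add, mul_sub, hΓ.normal]
  abel

theorem sum_skewMat (hΓ : IsTriangleRegular Γ) (x : V) : ∑ z, skewMat Γ x z = 0 := by
  have h := congrFun (congrFun hΓ.normal x) x
  simp only [mul_apply, transpose_apply] at h
  have hsq : ∀ y z, adjMat Γ y z * adjMat Γ y z = adjMat Γ y z := by
    intro y z
    by_cases hyz : Γ.Adj y z
    · simp [adjMat_of_adj hyz]
    · simp [adjMat_of_not_adj hyz]
  simp only [hsq] at h
  simp [skewMat, sum_sub_distrib, h]

/-- By normality `S N = A² - (Aᵀ)²` and `N² = A² + (Aᵀ)² + 2 A Aᵀ`, so on an edge both are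
determined by the triangle counts `p` and `q`. -/
theorem exists_mul_apply (hΓ : IsTriangleRegular Γ) : ∃ p q : ℕ, 1 ≤ q ∧
    ∀ x y, Γ.toSimpleGraphInclusive.Adj x y →
      (skewMat Γ * symMat Γ) x y = ((p : ℚ) - q) * skewMat Γ x y ∧
      (symMat Γ * symMat Γ) x y = 3 * p + q := by
  obtain ⟨p, q, hq, h⟩ := hΓ.triangles
  refine ⟨p, q, hq, fun x y hxy => ?_⟩
  have e1 : skewMat Γ * symMat Γ = adjMat Γ * adjMat Γ - (adjMat Γ)ᵀ * (adjMat Γ)ᵀ := by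
    simp only [skewMat, symMat, sub_mul, mul_add, hΓ.normal]
    abel
  have e2 : symMat Γ * symMat Γ = adjMat Γ * adjMat Γ + (adjMat Γ)ᵀ * (adjMat Γ)ᵀ +
      (adjMat Γ * (adjMat Γ)ᵀ + adjMat Γ * (adjMat Γ)ᵀ) := by
    simp only [symMat, add_mul, mul_add, hΓ.normal]
    abel
  have e3 : ∀ u v, (adjMat Γ * adjMat Γ) u v = ((adjMat Γ)ᵀ * (adjMat Γ)ᵀ) v u := by
    intro u v
    rw [← transpose_mul, transpose_apply]
  have e4 : ∀ u v, (adjMat Γ * (adjMat Γ)ᵀ) u v = (adjMat Γ * (adjMat Γ)ᵀ) v u := by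
    intro u v
    conv_rhs => rw [← transpose_apply (adjMat Γ * (adjMat Γ)ᵀ), transpose_mul, transpose_transpose]
  rw [e1, e2, Matrix.sub_apply, Matrix.add_apply, Matrix.add_apply, Matrix.add_apply]
  rcases (hΓ.adj_iff x y).1 hxy with h' | h'
  · obtain ⟨h1, h2, h3⟩ := h x y h'
    have : skewMat Γ x y = 1 := by
      simp [skewMat, adjMat_of_adj h', adjMat_of_not_adj (hΓ.asymm _ _ h')]
    rw [h1, h2, h3, this]
    exact ⟨by ring, by ring⟩
  · obtain ⟨h1, h2, h3⟩ := h y x h'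
    have : skewMat Γ x y = -1 := by
      simp [skewMat, adjMat_of_adj h', adjMat_of_not_adj (hΓ.asymm _ _ h')]
    rw [e3 x y, h3, ← e3 y x, h1, e4, h2, this]
    exact ⟨by ring, by ring⟩

end IsTriangleRegular

/-- The map `π` from the `e`-subsets of `α` to the vertices of `G` is a local isomorphism from the
Johnson graph: it identifies the neighbourhood of each vertex with a grid. -/
structure IsLocalGrid {α : Type*} [DecidableEq α] (G : SimpleGraph V) (e : ℕ)
    (π : Finset α → V) : Prop where
  adj : ∀ x : Finset α, x.card = e → ∀ a ∈ x, ∀ b ∉ x, G.Adj (π x) (π (insert b (x.erase a)))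
  surj : ∀ x : Finset α, x.card = e → ∀ z, G.Adj (π x) z →
    ∃ a ∈ x, ∃ b ∉ x, π (insert b (x.erase a)) = z
  inj : ∀ x : Finset α, x.card = e → ∀ a ∈ x, ∀ b ∉ x, ∀ c ∈ x, ∀ d ∉ x,
    π (insert b (x.erase a)) = π (insert d (x.erase c)) → a = c ∧ b = d
  adj_iff : ∀ x : Finset α, x.card = e → ∀ a ∈ x, ∀ b ∉ x, ∀ c ∈ x, ∀ d ∉ x,
    (G.Adj (π (insert b (x.erase a))) (π (insert d (x.erase c))) ↔
      (a = c ∧ b ≠ d) ∨ (a ≠ c ∧ b = d))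
  separates_eq : ∀ x y : Finset α, x.card = e → y.card = e → π x = π y →
    ∀ i j, separates i j x = separates i j y

namespace IsLocalGrid

variable {α : Type*} [DecidableEq α] [Fintype α] {e : ℕ} {π : Finset α → V} [Fintype V]

theorem sum_eq {G : SimpleGraph V} (hπ : IsLocalGrid G e π) {x : Finset α} (hx : x.card = e)
    {F : V → ℚ} (hF : ∀ z, ¬ G.Adj (π x) z → F z = 0) :
    ∑ z, F z = ∑ a ∈ x, ∑ b ∈ xᶜ, F (π (insert b (x.erase a))) := by
  classical
  rw [← sum_product']
  rw [← sum_image (s := x ×ˢ xᶜ) (f := F) (g := fun c => π (insert c.2 (x.erase c.1)))]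
  · refine (sum_subset (subset_univ _) fun z _ hz => hF z fun hadj => hz ?_).symm
    obtain ⟨a, ha, b, hb, rfl⟩ := hπ.surj x hx z hadj
    exact mem_image.2 ⟨(a, b), mem_product.2 ⟨ha, mem_compl.2 hb⟩, rfl⟩
  · rintro ⟨a, b⟩ hab ⟨c, d⟩ hcd heq
    simp only [coe_product, Set.mem_prod, mem_coe, mem_compl] at hab hcd
    obtain ⟨rfl, rfl⟩ := hπ.inj x hx a hab.1 b hab.2 c hcd.1 d hcd.2 heq
    rfl

theorem isRegularSigning (hΓ : IsTriangleRegular Γ)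
    (hπ : IsLocalGrid Γ.toSimpleGraphInclusive e π) (he : 1 ≤ e)
    (hcard : 2 * e ≤ Fintype.card α) :
    IsRegularSigning e fun (x : Finset α) a b => skewMat Γ (π x) (π (insert b (x.erase a))) := by
  -- Adjacency in the grid: same row or same column, with the common cell subtracted twice.
  have hsym : ∀ x : Finset α, x.card = e → ∀ a ∈ x, ∀ b ∉ x, ∀ c ∈ x, ∀ d ∉ x,
      symMat Γ (π (insert d (x.erase c))) (π (insert b (x.erase a))) =
        (if c = a then 1 else 0) + (if d = b then 1 else 0) -
          2 * ((if c = a then 1 else 0) * if d = b then 1 else 0) := by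
    intro x hx a ha b hb c hc d hd
    have h := hπ.adj_iff x hx c hc d hd a ha b hb
    by_cases h1 : c = a <;> by_cases h2 : d = b
    · rw [hΓ.symMat_of_not_adj (by rw [h]; tauto)]
      simp [h1, h2]
      norm_num
    · rw [hΓ.symMat_of_adj (by rw [h]; tauto)]
      simp [h1, h2]
    · rw [hΓ.symMat_of_adj (by rw [h]; tauto)]
      simp [h1, h2]
    · rw [hΓ.symMat_of_not_adj (by rw [h]; tauto)]
      simp [h1, h2]
  have hmul : ∀ x : Finset α, x.card = e → ∀ a ∈ x, ∀ b ∉ x, ∀ K : V → ℚ,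
      (∀ z, ¬ Γ.toSimpleGraphInclusive.Adj (π x) z → K z = 0) →
      ∑ z, K z * symMat Γ z (π (insert b (x.erase a))) =
        ∑ d ∈ xᶜ, K (π (insert d (x.erase a))) + ∑ c ∈ x, K (π (insert b (x.erase c))) -
          2 * K (π (insert b (x.erase a))) := by
    intro x hx a ha b hb K hK
    rw [hπ.sum_eq hx fun z hz => by rw [hK z hz, zero_mul],
      sum_congr rfl fun c hc => sum_congr rfl fun d hd => by
        rw [hsym x hx a ha b hb c hc d (mem_compl.1 hd)]]
    have hb' : b ∈ xᶜ := mem_compl.2 hb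
    simp only [mul_sub, mul_add, sum_sub_distrib, sum_add_distrib]
    congr 1
    · congr 1
      · rw [sum_eq_single a]
        · simp
        · intro c _ hc; simp [hc]
        · intro h; exact absurd ha h
      · refine sum_congr rfl fun c _ => ?_
        rw [sum_eq_single b]
        · simp
        · intro d _ hd; simp [hd]
        · intro h; exact absurd hb' h
    · rw [sum_eq_single a, sum_eq_single b]
      · simp; ring
      · intro d _ hd; simp [hd]
      · intro h; exact absurd hb' h
      · intro c _ hc; simp [hc]
      · intro h; exact absurd ha h
  refine ⟨?_, ?_, ?_, ?_, ?_⟩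
  · exact fun x hx a ha b hb => hΓ.skewMat_of_adj (hπ.adj x hx a ha b hb)
  · intro x hx a ha b hb
    have : insert a ((insert b (x.erase a)).erase b) = x := by
      rw [erase_insert (by simp [hb]), insert_erase ha]
    simp only [this]
    simp [skewMat]
  · intro x hx
    rw [← hπ.sum_eq hx (F := skewMat Γ (π x)) fun z hz => hΓ.skewMat_of_not_adj hz]
    exact hΓ.sum_skewMat _
  · obtain ⟨p, q, hq, hpq⟩ := hΓ.exists_mul_apply
    refine ⟨p, q, hq, ?_, fun x hx a ha b hb => ?_⟩
    · obtain ⟨x, -, hx⟩ := exists_subset_card_eq (s := (univ : Finset α)) (n := e)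
        (by rw [card_univ]; omega)
      obtain ⟨a, ha⟩ := card_pos.1 (by omega : 0 < x.card)
      obtain ⟨b, hb⟩ := card_pos.1 (by rw [card_compl]; omega : 0 < (xᶜ).card)
      rw [mem_compl] at hb
      have h := (hpq _ _ (hπ.adj x hx a ha b hb)).2
      rw [mul_apply, hmul x hx a ha b hb _ fun z hz => hΓ.symMat_of_not_adj hz,
        sum_congr rfl fun d hd => hΓ.symMat_of_adj (hπ.adj x hx a ha d (mem_compl.1 hd)),
        sum_congr rfl fun c hc => hΓ.symMat_of_adj (hπ.adj x hx c hc b hb),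
        hΓ.symMat_of_adj (hπ.adj x hx a ha b hb), sum_const, sum_const, nsmul_eq_mul,
        nsmul_eq_mul, IsRegularSigning.card_compl_cast hcard hx, hx] at h
      have : ((3 * p + q + 2 : ℕ) : ℚ) = (Fintype.card α : ℕ) := by
        push_cast
        linarith
      exact_mod_cast this
    · have h := (hpq _ _ (hπ.adj x hx a ha b hb)).1
      rw [mul_apply, hmul x hx a ha b hb _ fun z hz => hΓ.skewMat_of_not_adj hz] at h
      linarith
  · intro i j x hx
    -- `separates i j` is constant on the fibres of `π`, hence descends to the vertices, where the
    -- matrix commutation applies. The value 0 off the image is arbitrary.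
    obtain ⟨f, hf⟩ : ∃ f : V → ℚ, ∀ y, y.card = e → separates i j y = f (π y) := by
      classical
      refine ⟨fun z => if h : ∃ y, y.card = e ∧ π y = z then separates i j h.choose else 0,
        fun y hy => ?_⟩
      have h : ∃ y', y'.card = e ∧ π y' = π y := ⟨y, hy, rfl⟩
      simp only [dif_pos h]
      exact hπ.separates_eq _ _ hy h.choose_spec.1 h.choose_spec.2.symm i j
    have hN : ∀ (g : Finset α → ℚ) (g' : V → ℚ), (∀ y, y.card = e → g y = g' (π y)) →
        ∀ y, y.card = e → swapSum univ g y = (symMat Γ *ᵥ g') (π y) := by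
      intro g g' hg y hy
      rw [mulVec, dotProduct,
        hπ.sum_eq hy fun z hz => by rw [hΓ.symMat_of_not_adj hz, zero_mul], swapSum,
        ← compl_eq_univ_sdiff]
      refine sum_congr rfl fun a ha => sum_congr rfl fun b hb => ?_
      rw [mem_compl] at hb
      rw [hΓ.symMat_of_adj (hπ.adj y hy a ha b hb), one_mul, hg _ ((card_swap ha hb).trans hy)]
    have hS : ∀ (g : Finset α → ℚ) (g' : V → ℚ), (∀ y, y.card = e → g y = g' (π y)) →
        ∀ y, y.card = e → signedSum (fun (x : Finset α) a b =>
          skewMat Γ (π x) (π (insert b (x.erase a)))) g y = (skewMat Γ *ᵥ g') (π y) := by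
      intro g g' hg y hy
      rw [mulVec, dotProduct,
        hπ.sum_eq hy fun z hz => by rw [hΓ.skewMat_of_not_adj hz, zero_mul], signedSum]
      refine sum_congr rfl fun a ha => sum_congr rfl fun b hb => ?_
      rw [mem_compl] at hb
      rw [hg _ ((card_swap ha hb).trans hy)]
    rw [hS _ _ (hN _ _ hf) x hx, hN _ _ (hS _ _ hf) x hx, mulVec_mulVec, mulVec_mulVec,
      hΓ.skewMat_mul_symMat_comm]

theorem false_of_three_le (hΓ : IsTriangleRegular Γ)
    (hπ : IsLocalGrid Γ.toSimpleGraphInclusive e π) (he : 3 ≤ e)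
    (hcard : 2 * e ≤ Fintype.card α) : False :=
  (hπ.isRegularSigning hΓ (by omega) hcard).false_of_three_le he hcard

end IsLocalGrid

end Orientation

/-! ### From the scheme to the adjacency matrix -/

section FromScheme

open Finset Matrix

variable {V : Type*} {Γ : Digraph V}

theorem hasPath_zero_iff {x y : V} : HasPath Γ 0 x y ↔ x = y := by
  constructor
  · rintro ⟨w, rfl, rfl, -⟩
    rfl
  · rintro rfl
    exact ⟨fun _ => x, rfl, rfl, fun t ht => absurd ht (Nat.not_lt_zero t)⟩

theorem hasPath_one_iff {x y : V} : HasPath Γ 1 x y ↔ Γ.Adj x y := by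
  constructor
  · rintro ⟨w, rfl, rfl, h⟩
    exact h 0 one_pos
  · intro h
    refine ⟨fun t => if t = 0 then x else y, rfl, rfl, fun t ht => ?_⟩
    obtain rfl : t = 0 := by omega
    exact h

theorem exists_of_hasPath_two {x y : V} (h : HasPath Γ 2 x y) : ∃ z, Γ.Adj x z ∧ Γ.Adj z y := by
  obtain ⟨w, rfl, rfl, h⟩ := h
  exact ⟨w 1, h 0 two_pos, h 1 one_lt_two⟩

theorem hasPath_dist (hΓ : StronglyConnected Γ) (x y : V) : HasPath Γ (dist Γ x y) x y :=
  Nat.sInf_mem (s := {r | HasPath Γ r x y}) (hΓ x y)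

theorem dist_eq_one_iff (hl : ∀ x, ¬ Γ.Adj x x) (hΓ : StronglyConnected Γ) {x y : V} :
    dist Γ x y = 1 ↔ Γ.Adj x y := by
  constructor
  · intro h
    have := hasPath_dist hΓ x y
    rwa [h, hasPath_one_iff] at this
  · intro h
    have h1 : dist Γ x y ≤ 1 := Nat.sInf_le (hasPath_one_iff.2 h)
    have h0 : dist Γ x y ≠ 0 := by
      intro h0
      have := hasPath_dist hΓ x y
      rw [h0, hasPath_zero_iff] at this
      exact hl x (this ▸ h)
    omega

theorem adj_iff_twoDist_eq (hΓ : IsCommWeaklyDistanceRegular Γ) (hT : arcTypes Γ = {3}) {x y : V} :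
    Γ.Adj x y ↔ twoDist Γ x y = (1, 2) := by
  constructor
  · intro h
    have h1 := (dist_eq_one_iff hΓ.loopless hΓ.stronglyConnected).2 h
    have h2 : dist Γ y x + 1 ∈ arcTypes Γ := ⟨_, ⟨x, y, by rw [twoDist, h1]⟩, rfl⟩
    rw [hT, Set.mem_singleton_iff] at h2
    rw [twoDist, h1, show dist Γ y x = 2 by omega]
  · intro h
    exact (dist_eq_one_iff hΓ.loopless hΓ.stronglyConnected).1 (congrArg Prod.fst h)

open scoped Classical in
/-- The intersection numbers are the entries of the products of the relation matrices. -/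
theorem cast_interCount [Fintype V] {I : Type*} (R : I → Set (V × V)) (i j : I) (x y : V)
    {A B : Matrix V V ℚ} (hA : ∀ x z, A x z = if (x, z) ∈ R i then 1 else 0)
    (hB : ∀ z y, B z y = if (z, y) ∈ R j then 1 else 0) :
    (interCount R i j x y : ℚ) = (A * B) x y := by
  rw [mul_apply, interCount, Set.ncard_eq_toFinset_card', Set.toFinset_ofPred]
  simp only [hA, hB, ite_zero_mul_ite_zero, mul_one, sum_boole]

theorem isTriangleRegular [Fintype V] (hΓ : IsCommWeaklyDistanceRegular Γ)
    (hT : arcTypes Γ = {3}) : IsTriangleRegular Γ := by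
  classical
  have hadj := fun x y => adj_iff_twoDist_eq (x := x) (y := y) hΓ hT
  obtain ⟨a, b, hab⟩ : ∃ a b, Γ.Adj a b := by
    have h3 : 3 ∈ arcTypes Γ := by rw [hT]; rfl
    obtain ⟨q, ⟨a, b, hab⟩, hq⟩ := h3
    exact ⟨a, b, (dist_eq_one_iff hΓ.loopless hΓ.stronglyConnected).1 (congrArg Prod.fst hab)⟩
  have hswap : ∀ x y, twoDist Γ y x = (twoDist Γ x y).swap := fun x y => rfl
  have hadj' : ∀ x y, Γ.Adj y x ↔ twoDist Γ x y = (2, 1) := by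
    intro x y
    rw [hadj, hswap x y, ← Prod.swap_inj, Prod.swap_swap]
    rfl
  let r : twoDistSet Γ := ⟨(1, 2), a, b, (hadj a b).1 hab⟩
  let r' : twoDistSet Γ := ⟨(2, 1), b, a, (hadj' b a).1 hab⟩
  have hr : ∀ x y, adjMat Γ x y = if (x, y) ∈ attached Γ r then 1 else 0 := by
    intro x y
    rw [adjMat, of_apply]
    exact if_congr (hadj x y) rfl rfl
  have hr' : ∀ x y, (adjMat Γ)ᵀ x y = if (x, y) ∈ attached Γ r' then 1 else 0 := by
    intro x y
    rw [transpose_apply, adjMat, of_apply]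
    exact if_congr (hadj' x y) rfl rfl
  have hasymm : ∀ x y, Γ.Adj x y → ¬ Γ.Adj y x := by
    intro x y h h'
    rw [hadj] at h
    rw [hadj', h] at h'
    simp at h'
  have hnormal : adjMat Γ * (adjMat Γ)ᵀ = (adjMat Γ)ᵀ * adjMat Γ := by
    ext x y
    rw [← cast_interCount _ _ _ x y hr hr', ← cast_interCount _ _ _ x y hr' hr]
    exact_mod_cast hΓ.commutative r r' ⟨twoDist Γ x y, x, y, rfl⟩ x y rfl
  refine ⟨hasymm, hnormal, ?_⟩
  obtain ⟨p, hp⟩ := hΓ.scheme.interNumber r r r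
  obtain ⟨s, hs⟩ := hΓ.scheme.interNumber r r' r
  obtain ⟨q, hq⟩ := hΓ.scheme.interNumber r' r' r
  have hp' : ∀ x y, Γ.Adj x y → (adjMat Γ * adjMat Γ) x y = p := fun x y h => by
    rw [← cast_interCount _ _ _ x y hr hr, hp x y ((hadj x y).1 h)]
  have hs' : ∀ x y, Γ.Adj x y → (adjMat Γ * (adjMat Γ)ᵀ) x y = s := fun x y h => by
    rw [← cast_interCount _ _ _ x y hr hr', hs x y ((hadj x y).1 h)]
  have hq' : ∀ x y, Γ.Adj x y → ((adjMat Γ)ᵀ * (adjMat Γ)ᵀ) x y = q := fun x y h => by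
    rw [← cast_interCount _ _ _ x y hr' hr', hq x y ((hadj x y).1 h)]
  -- Both sides count the transitive triangles with source `a`: the two out-neighbours of `a` play
  -- exchanged roles, and `a` has an out-neighbour, so the common factor cancels.
  have hps : (p : ℚ) = s := by
    have h1 : ∀ c : ℚ, ∀ B : Matrix V V ℚ, (∀ x y, Γ.Adj x y → B x y = c) →
        ∑ y, adjMat Γ a y * B a y = (∑ y, adjMat Γ a y) * c := by
      intro c B hB
      rw [sum_mul]
      refine sum_congr rfl fun y _ => ?_
      by_cases h : Γ.Adj a y
      · rw [hB a y h]
      · rw [adjMat_of_not_adj h, zero_mul, zero_mul]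
    have h2 : ∑ y, adjMat Γ a y * (adjMat Γ * adjMat Γ) a y =
        ∑ y, adjMat Γ a y * (adjMat Γ * (adjMat Γ)ᵀ) a y := by
      simp only [mul_apply, transpose_apply, mul_sum]
      rw [sum_comm]
      refine sum_congr rfl fun y _ => sum_congr rfl fun z _ => ?_
      ring
    rw [h1 _ _ hp', h1 _ _ hs'] at h2
    refine mul_left_cancel₀ (ne_of_gt ?_) h2
    refine sum_pos' (fun y _ => ?_) ⟨b, mem_univ _, by rw [adjMat_of_adj hab]; norm_num⟩
    by_cases h : Γ.Adj a y
    · rw [adjMat_of_adj h]; norm_num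
    · rw [adjMat_of_not_adj h]
  refine ⟨p, q, ?_, fun x y h => ⟨hp' x y h, (hs' x y h).trans hps.symm, hq' x y h⟩⟩
  -- The return path of length 2 closes the arc from `a` to `b` to a cyclic triangle, so `q ≥ 1`.
  have h2 : dist Γ b a = 2 := congrArg Prod.snd ((hadj a b).1 hab)
  have hpath := hasPath_dist hΓ.stronglyConnected b a
  rw [h2] at hpath
  obtain ⟨z, hbz, hza⟩ := exists_of_hasPath_two hpath
  rw [← hq a b ((hadj a b).1 hab), interCount, Nat.one_le_iff_ne_zero, Ne,
    Set.ncard_eq_zero (Set.toFinite _)]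
  exact Set.Nonempty.ne_empty ⟨z, (hadj' a z).1 hza, (hadj' z b).1 hbz⟩

end FromScheme

/-! ### Johnson graphs and folded Johnson graphs are locally grids -/

section Grids

open Finset

variable {V W α : Type*} [DecidableEq α] {x : Finset α}

theorem inter_swap_eq {a b : α} (hb : b ∉ x) : x ∩ insert b (x.erase a) = x.erase a := by
  rw [inter_insert_of_notMem hb, inter_eq_right]
  exact erase_subset _ _

theorem card_swap_inter_swap {e : ℕ} (hx : x.card = e) {a b c d : α} (ha : a ∈ x) (hb : b ∉ x)
    (hc : c ∈ x) (hd : d ∉ x) :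
    (insert b (x.erase a) ∩ insert d (x.erase c)).card + (if a = c then 0 else 1) +
      (if b = d then 0 else 1) = e := by
  have hE : x.erase a ∩ insert d (x.erase c) = (x.erase a).erase c := by
    rw [inter_insert_of_notMem (fun h => hd (mem_of_mem_erase h))]
    ext z
    simp only [mem_inter, mem_erase]
    tauto
  have hcE : ((x.erase a).erase c).card + (if a = c then 0 else 1) + 1 = e := by
    split_ifs with h
    · subst h
      rw [erase_eq_of_notMem (notMem_erase _ _), add_zero, card_erase_add_one ha, hx]
    · rw [card_erase_add_one (mem_erase.2 ⟨Ne.symm h, hc⟩), card_erase_add_one ha, hx]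
  by_cases hbd : b = d
  · rw [if_pos hbd, insert_inter_of_mem (by simp [hbd]), hE, card_insert_of_notMem (by simp [hb])]
    omega
  · rw [if_neg hbd, insert_inter_of_notMem (by simp [hbd, hb]), hE]
    omega

theorem exists_swap_eq {e : ℕ} (hx : x.card = e) {y : Finset α} (hy : y.card = e)
    (hxy : (x ∩ y).card + 1 = e) : ∃ a ∈ x, ∃ b ∉ x, insert b (x.erase a) = y := by
  have h1 : (x \ y).card = 1 := by
    have := card_inter_add_card_sdiff x y
    omega
  have h2 : (y \ x).card = 1 := by
    have := card_inter_add_card_sdiff y x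
    rw [inter_comm] at this
    omega
  obtain ⟨a, ha⟩ := card_eq_one.1 h1
  obtain ⟨b, hb⟩ := card_eq_one.1 h2
  have ha' : ∀ z, z ∈ x ∧ z ∉ y ↔ z = a := fun z => by rw [← mem_sdiff, ha, mem_singleton]
  have hb' : ∀ z, z ∈ y ∧ z ∉ x ↔ z = b := fun z => by rw [← mem_sdiff, hb, mem_singleton]
  refine ⟨a, ((ha' a).2 rfl).1, b, ((hb' b).2 rfl).2, ?_⟩
  ext z
  rw [mem_insert, mem_erase, Ne, ← ha', ← hb']
  tauto

/-- Two neighbours of an `e`-set meet in at least `e - 2` elements, so nonadjacency and injectivity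
need checking only in that range. -/
theorem isLocalGrid_of_card_inter {G : SimpleGraph V} {e : ℕ} {π : Finset α → V}
    (hsurj : ∀ x : Finset α, x.card = e → ∀ z, G.Adj (π x) z →
      ∃ y : Finset α, y.card = e ∧ (x ∩ y).card + 1 = e ∧ π y = z)
    (hadj : ∀ x y : Finset α, x.card = e → y.card = e → (x ∩ y).card + 1 = e →
      G.Adj (π x) (π y))
    (hnadj : ∀ x y : Finset α, x.card = e → y.card = e → (x ∩ y).card + 2 = e →
      ¬ G.Adj (π x) (π y))
    (hinj : ∀ x y : Finset α, x.card = e → y.card = e → e ≤ (x ∩ y).card + 2 →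
      π x = π y → x = y)
    (hsep : ∀ x y : Finset α, x.card = e → y.card = e → π x = π y →
      ∀ i j, separates i j x = separates i j y) :
    IsLocalGrid G e π := by
  refine ⟨?_, ?_, ?_, ?_, hsep⟩
  · intro x hx a ha b hb
    refine hadj _ _ hx ((card_swap ha hb).trans hx) ?_
    rw [inter_swap_eq hb, card_erase_add_one ha, hx]
  · intro x hx z hz
    obtain ⟨y, hy, hxy, rfl⟩ := hsurj x hx z hz
    obtain ⟨a, ha, b, hb, rfl⟩ := exists_swap_eq hx hy hxy
    exact ⟨a, ha, b, hb, rfl⟩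
  · intro x hx a ha b hb c hc d hd h
    have hcard := card_swap_inter_swap hx ha hb hc hd
    have heq := hinj _ _ ((card_swap ha hb).trans hx) ((card_swap hc hd).trans hx)
      (by split_ifs at hcard <;> omega) h
    rw [heq, inter_self, card_swap hc hd] at hcard
    split_ifs at hcard with h1 h2 h2
    · exact ⟨h1, h2⟩
    all_goals omega
  · intro x hx a ha b hb c hc d hd
    have hcard := card_swap_inter_swap hx ha hb hc hd
    have hy := (card_swap ha hb).trans hx
    have hy' := (card_swap hc hd).trans hx
    by_cases h1 : a = c <;> by_cases h2 : b = d
    · simp [h1, h2]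
    · simp only [h1, h2, if_true, if_false] at hcard
      simpa [h1, h2] using hadj _ _ (h1 ▸ hy) hy' hcard
    · simp only [h1, h2, if_true, if_false] at hcard
      simpa [h1, h2] using hadj _ _ (h2 ▸ hy) hy' hcard
    · simp only [h1, h2, if_false] at hcard
      simpa [h1, h2] using hnadj _ _ hy hy' hcard

theorem IsLocalGrid.symm_comp {G : SimpleGraph V} {H : SimpleGraph W} {e : ℕ}
    {π : Finset α → W} (hπ : IsLocalGrid H e π) (φ : G ≃g H) :
    IsLocalGrid G e fun x => φ.symm (π x) := by
  refine ⟨fun x hx a ha b hb => φ.symm.map_adj_iff.2 (hπ.adj x hx a ha b hb),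
    fun x hx z hz => ?_, fun x hx a ha b hb c hc d hd h =>
      hπ.inj x hx a ha b hb c hc d hd (φ.symm.injective h),
    fun x hx a ha b hb c hc d hd => by
      rw [φ.symm.map_adj_iff, hπ.adj_iff x hx a ha b hb c hc d hd],
    fun x y hx hy h => hπ.separates_eq x y hx hy (φ.symm.injective h)⟩
  obtain ⟨a, ha, b, hb, h⟩ := hπ.surj x hx (φ z) (by
    rw [← φ.symm.map_adj_iff, φ.symm_apply_apply]
    exact hz)
  exact ⟨a, ha, b, hb, by rw [h, φ.symm_apply_apply]⟩

theorem exists_isLocalGrid_johnson {n e : ℕ} (hn : 2 * e ≤ n) :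
    ∃ π : Finset (Fin n) → _, IsLocalGrid (johnson n e) e π := by
  obtain ⟨x₀, -, hx₀⟩ := exists_subset_card_eq (s := (univ : Finset (Fin n))) (n := e)
    (by rw [card_univ, Fintype.card_fin]; omega)
  refine ⟨fun x => if h : x.card = e then ⟨x, h⟩ else ⟨x₀, hx₀⟩,
    isLocalGrid_of_card_inter ?_ ?_ ?_ ?_ ?_⟩
  · intro x hx z hz
    rw [dif_pos hx] at hz
    exact ⟨z.1, z.2, hz, by rw [dif_pos z.2]⟩
  · intro x y hx hy h
    rw [dif_pos hx, dif_pos hy]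
    exact h
  · intro x y hx hy h hadj
    rw [dif_pos hx, dif_pos hy] at hadj
    change (x ∩ y).card + 1 = e at hadj
    omega
  · intro x y hx hy _ h
    rw [dif_pos hx, dif_pos hy] at h
    exact congrArg Subtype.val h
  · intro x y hx hy h i j
    rw [dif_pos hx, dif_pos hy] at h
    rw [show x = y from congrArg Subtype.val h]

theorem pair_compl_eq_iff [Fintype α] {x y : Finset α} :
    ({x, xᶜ} : Finset (Finset α)) = {y, yᶜ} ↔ x = y ∨ x = yᶜ := by
  constructor
  · intro h
    have : x ∈ ({y, yᶜ} : Finset (Finset α)) := h ▸ mem_insert_self _ _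
    simpa using this
  · rintro (rfl | rfl)
    · rfl
    · rw [compl_compl, pair_comm]

theorem exists_isLocalGrid_foldedJohnson {e : ℕ} (he : 4 ≤ e) :
    ∃ π : Finset (Fin (2 * e)) → _, IsLocalGrid (foldedJohnson e) e π := by
  obtain ⟨x₀, -, hx₀⟩ := exists_subset_card_eq (s := (univ : Finset (Fin (2 * e)))) (n := e)
    (by rw [card_univ, Fintype.card_fin]; omega)
  have hcompl : ∀ y : Finset (Fin (2 * e)), y.card = e → yᶜ.card = e := by
    intro y hy
    rw [card_compl, hy, Fintype.card_fin]
    omega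
  have hic : ∀ x y : Finset (Fin (2 * e)), x.card = e →
      (x ∩ y).card + (x ∩ yᶜ).card = e := by
    intro x y hx
    rw [← sdiff_eq_inter_compl, card_inter_add_card_sdiff, hx]
  have hiff : ∀ (x y : Finset (Fin (2 * e))) (hx : x.card = e) (hy : y.card = e),
      (foldedJohnson e).Adj ⟨{x, xᶜ}, x, hx, rfl⟩ ⟨{y, yᶜ}, y, hy, rfl⟩ ↔
        (x ∩ y).card = 1 ∨ (x ∩ y).card + 1 = e := by
    intro x y hx hy
    have h1 := hic x y hx
    have h2 := hic xᶜ y (hcompl x hx)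
    have h3 := hic y x hy
    rw [inter_comm y x, inter_comm y] at h3
    constructor
    · rintro ⟨-, x', hx', y', hy', h⟩
      simp only [mem_insert, mem_singleton] at hx' hy'
      rcases hx' with rfl | rfl <;> rcases hy' with rfl | rfl <;> omega
    · intro h
      refine ⟨fun heq => ?_, x, mem_insert_self _ _, y, mem_insert_self _ _, h⟩
      rcases pair_compl_eq_iff.1 (congrArg Subtype.val heq) with rfl | rfl
      · rw [inter_self] at h; omega
      · rw [inter_comm, inter_compl, card_empty] at h; omega
  refine ⟨fun x => if h : x.card = e then ⟨{x, xᶜ}, x, h, rfl⟩ else ⟨{x₀, x₀ᶜ}, x₀, hx₀, rfl⟩,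
    isLocalGrid_of_card_inter ?_ ?_ ?_ ?_ ?_⟩
  · rintro x hx ⟨P, y, hy, rfl⟩ hz
    rw [dif_pos hx, hiff x y hx hy] at hz
    rcases hz with h | h
    · refine ⟨yᶜ, hcompl y hy, ?_, ?_⟩
      · have := hic x y hx
        omega
      · rw [dif_pos (hcompl y hy), Subtype.mk.injEq, pair_compl_eq_iff]
        exact Or.inr rfl
    · exact ⟨y, hy, h, by rw [dif_pos hy]⟩
  · intro x y hx hy h
    rw [dif_pos hx, dif_pos hy, hiff x y hx hy]
    exact Or.inr h
  -- This is where `e ≥ 4` matters: for `e = 3`, sets meeting in `e - 2 = 1` element would become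
  -- adjacent after folding.
  · intro x y hx hy h
    rw [dif_pos hx, dif_pos hy, hiff x y hx hy]
    omega
  · intro x y hx hy hxy h
    rw [dif_pos hx, dif_pos hy, Subtype.mk.injEq, pair_compl_eq_iff] at h
    refine h.resolve_right ?_
    rintro rfl
    rw [inter_comm, inter_compl, card_empty] at hxy
    omega
  · intro x y hx hy h i j
    rw [dif_pos hx, dif_pos hy, Subtype.mk.injEq, pair_compl_eq_iff] at h
    rcases h with rfl | rfl
    · rfl
    · simp only [separates, mem_compl, not_iff_not]

end Grids

/-! ### Exclusion of Johnson graphs with `e ≥ 3` and of folded Johnson graphs -/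

section Main

variable {V : Type*} [Finite V] {Γ : Digraph V}

theorem isEmpty_iso_johnson (hΓ : IsCommWeaklyDistanceRegular Γ) (hT : arcTypes Γ = {3})
    {n e : ℕ} (he : 3 ≤ e) (hn : 2 * e ≤ n) :
    IsEmpty (Γ.toSimpleGraphInclusive ≃g johnson n e) := by
  refine ⟨fun φ => ?_⟩
  have := Fintype.ofFinite V
  obtain ⟨π, hπ⟩ := exists_isLocalGrid_johnson hn
  exact (hπ.symm_comp φ).false_of_three_le (isTriangleRegular hΓ hT) he (by simpa using hn)

theorem isEmpty_iso_foldedJohnson (hΓ : IsCommWeaklyDistanceRegular Γ) (hT : arcTypes Γ = {3})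
    {e : ℕ} (he : 4 ≤ e) : IsEmpty (Γ.toSimpleGraphInclusive ≃g foldedJohnson e) := by
  refine ⟨fun φ => ?_⟩
  have := Fintype.ofFinite V
  obtain ⟨π, hπ⟩ := exists_isLocalGrid_foldedJohnson he
  exact (hπ.symm_comp φ).false_of_three_le (isTriangleRegular hΓ hT) (by omega) (by simp)

end Main

end WDRD

theorem proposition5p1 {V : Type*} [Finite V] (Γ : Digraph V)
    (hΓ : WDRD.IsCommWeaklyDistanceRegular Γ) (m e : ℕ)
    (hJ : (2 ≤ e ∧ 2 * e ≤ m ∧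
            Nonempty (Γ.toSimpleGraphInclusive ≃g WDRD.johnson m e)) ∨
          (4 ≤ e ∧ m = 2 * e ∧
            Nonempty (Γ.toSimpleGraphInclusive ≃g WDRD.foldedJohnson e)))
    (hT : WDRD.arcTypes Γ = {3}) :
    Nonempty (Γ.toSimpleGraphInclusive ≃g WDRD.johnson m 2) ∧
      (∀ n' e' : ℕ, 2 < e' → 2 * e' ≤ n' →
        IsEmpty (Γ.toSimpleGraphInclusive ≃g WDRD.johnson n' e')) ∧
      (∀ e' : ℕ, 4 ≤ e' →
        IsEmpty (Γ.toSimpleGraphInclusive ≃g WDRD.foldedJohnson e')) := by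
  refine ⟨?_, fun n' e' he' hn' => WDRD.isEmpty_iso_johnson hΓ hT he' hn',
    fun e' he' => WDRD.isEmpty_iso_foldedJohnson hΓ hT he'⟩
  rcases hJ with ⟨he, hm, hφ⟩ | ⟨he, -, ⟨φ⟩⟩
  · rcases he.eq_or_lt with rfl | he
    · exact hφ
    · exact ((WDRD.isEmpty_iso_johnson hΓ hT he hm).false hφ.some).elim
  · exact ((WDRD.isEmpty_iso_foldedJohnson hΓ hT he).false φ).elim
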